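/- **Setting.** Let $N$ be a free abelian group of finite rank, $M=\operatorname{Hom}(N,\mathbb Z)$, and $\Sigma$ a fan in $N$: a finite collection of strongly convex rational polyhedral cones in $N_{\mathbb Q}$, closed under taking faces, any two of which meet in a common face. Let $X$ be its toric variety. For $\sigma\in\Sigma$ let $N_\sigma$ be the subgroup generated by $\sigma\cap N$, $N(\sigma)=N/N_\sigma$, and $M(\sigma)=M\cap\sigma^\perp$, the dual of $N(\sigma)$. Write $\tau\to\sigma$ if $\sigma$ is a maximal proper face of $\tau$; then $n_{\tau,\sigma}\in N(\sigma)$ denotes the first lattice point on the ray that is the image of $\tau$ in $N(\sigma)_{\mathbb Q}$. The group $Z_*(X)_{\mathbb Q}$ of invariant cycles is the $\mathbb Q$-vector space with basis the symbols $[V(\sigma)]$, $\sigma\in\Sigma$. A *$\mathbb Q$-Cartier divisor* $D$ on $X$ is a family of local equations $m_\sigma\in M_{\mathbb Q}/M(\sigma)_{\mathbb Q}$, $\sigma\in\Sigma$, such that $m_\sigma\mapsto m_\tau$ whenever $\tau$ is a face of $\sigma$. A *choice of complements* $\Psi$ for $\Sigma$ assigns to each $\sigma\in\Sigma$ a subspace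 $\Psi(\sigma)$ of $M_{\mathbb Q}$ complementary to $M(\sigma)_{\mathbb Q}$, with $\Psi(\tau)\subset\Psi(\sigma)$ if $\tau$ is a face of $\sigma$. Let $\pi_\sigma$ be the projection $M_{\mathbb Q}\to M(\sigma)_{\mathbb Q}$ along $\Psi(\sigma)$, and also the induced map $M_{\mathbb Q}/M(\tau)_{\mathbb Q}\to M(\sigma)_{\mathbb Q}/M(\tau)_{\mathbb Q}$ if $\sigma$ is a face of $\tau$. The action of $D$ on invariant cycles determined by $\Psi$ is the linear map with $$D\cdot[V(\sigma)]=\sum_{\tau\to\sigma}\langle \pi_\sigma(m_\tau),n_{\tau,\sigma}\rangle\,[V(\tau)].$$ Let $\Sigma'$ be a fan in $N'$ with toric variety $X'$ (and $M'$, $M'(\sigma')$, ... as above), and let $f:X'\to X$ be the toric map given by a homomorphism $\phi:N'\to N$ that maps every cone of $\Sigma'$ into a cone of $\Sigma$. Let $\phi^*$ be the dual map, and let $c(\sigma')$ be the smallest cone of $\Sigma$ containing $\phi(\sigma')$. The map $f$ is *proper* if $\phi^{-1}(|\Sigma|)=|\Sigma'|$. The pullback $f^*(D)$ has local equations $\phi^*(m_{c(\sigma')})$,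 $\sigma'\in\Sigma'$. The push forward is the linear map with $$f_*([V(\sigma')])=\begin{cases}[M'(\sigma'):\phi^*(M(c(\sigma')))]\,[V(c(\sigma'))] & \text{if } \operatorname{codim}c(\sigma')=\operatorname{codim}\sigma',\\ 0&\text{otherwise,}\end{cases}$$ where an infinite index is read as $0$ (in that case the image of $V(\sigma')$ has smaller dimension than $V(\sigma')$). We assume that $\operatorname{codim}c(\sigma')\le\operatorname{codim}\sigma'$ for all $\sigma'\in\Sigma'$, so that $f_*$ takes invariant cycles to invariant cycles; this holds, for example, if $\phi\otimes\mathbb Q$ is surjective. **Theorem (projection formula).** Let $f:X'\to X$ be a proper toric map as above. Let $\Psi'$ and $\Psi$ be choices of complements for $\Sigma'$ and $\Sigma$ such that $\phi^*(\Psi(\sigma))\subset\Psi'(\sigma')$ whenever $\sigma'\in\Sigma'$, $\sigma\in\Sigma$, $\phi(\sigma')\subset\sigma$ and $\sigma'$, $\sigma$ have the same codimension. Then for every $\mathbb Q$-Cartier divisor $D$ on $X$ and every $\sigma'\in\Sigma'$, $$f_*\bigl(f^*(D)\cdot[V(\sigma')]\bigr)=D\cdot f_*([V(\sigma')]),$$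 where $f^*(D)$ acts through $\Psi'$ and $D$ acts through $\Psi$. -/

import Mathlib

open scoped TensorProduct Classical

noncomputable section

namespace ToricCycles

/-- `N_ℚ = ℚ ⊗ N`. -/
abbrev NQ (N : Type*) [AddCommGroup N] : Type _ := ℚ ⊗[ℤ] N

/-- `M_ℚ`, the rational dual space of `N_ℚ`. -/
abbrev MQ (N : Type*) [AddCommGroup N] : Type _ := Module.Dual ℚ (NQ N)

/-- A (finite) fan in `N`: a finite collection of strongly convex rational polyhedral cones in
`N_ℚ`, containing the faces of its members, in which any two members meet in a common face.
A finitely generated cone over `ℚ` in `N_ℚ` is automatically generated by lattice vectors. -/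
structure Fan (N : Type*) [AddCommGroup N] where
  cones : Finset (PointedCone ℚ (NQ N))
  polyhedral : ∀ σ ∈ cones, σ.FG
  salient : ∀ σ ∈ cones, (σ : ConvexCone ℚ (NQ N)).Salient
  face_mem : ∀ σ ∈ cones, ∀ τ : PointedCone ℚ (NQ N), τ.IsFaceOf σ → τ ∈ cones
  inf_face : ∀ σ ∈ cones, ∀ τ ∈ cones, (σ ⊓ τ).IsFaceOf σ ∧ (σ ⊓ τ).IsFaceOf τ

section Cones

variable {N : Type*} [AddCommGroup N]

/-- The codimension of a cone in `N_ℚ`. -/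
def codim (σ : PointedCone ℚ (NQ N)) : ℕ :=
  Module.finrank ℚ (NQ N ⧸ Submodule.span ℚ (σ : Set (NQ N)))

/-- `σ` is a facet (a maximal proper face) of `τ`, written `τ → σ`. -/
def IsFacet (σ τ : PointedCone ℚ (NQ N)) : Prop :=
  σ.IsFaceOf τ ∧ σ ≠ τ ∧
    ∀ ρ : PointedCone ℚ (NQ N), ρ.IsFaceOf τ → σ ≤ ρ → ρ = σ ∨ ρ = τ

/-- `M(σ)_ℚ = σ^⊥`, a subspace of `M_ℚ`. -/
def perp (σ : PointedCone ℚ (NQ N)) : Submodule ℚ (MQ N) :=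
  (Submodule.span ℚ (σ : Set (NQ N))).dualAnnihilator

lemma perp_anti {σ τ : PointedCone ℚ (NQ N)} (h : σ ≤ τ) : perp τ ≤ perp σ :=
  Submodule.dualAnnihilator_anti (Submodule.span_mono h)

lemma mem_perp {σ : PointedCone ℚ (NQ N)} {m : MQ N} (hm : m ∈ perp σ) {x : NQ N} (hx : x ∈ σ) :
    m x = 0 :=
  (Submodule.mem_dualAnnihilator m).1 hm x (Submodule.subset_span hx)

/-- The monoid `σ ∩ N` of lattice points of a cone. -/
def latticePoints (σ : PointedCone ℚ (NQ N)) : AddSubmonoid N where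
  carrier := {v | (1 : ℚ) ⊗ₜ[ℤ] v ∈ σ}
  zero_mem' := by simp
  add_mem' := by
    intro a b ha hb
    change (1 : ℚ) ⊗ₜ[ℤ] (a + b) ∈ σ
    rw [TensorProduct.tmul_add]
    exact add_mem ha hb

/-- `N_σ`, the subgroup of `N` generated by `σ ∩ N`. -/
def subLattice (σ : PointedCone ℚ (NQ N)) : Submodule ℤ N :=
  Submodule.span ℤ (latticePoints σ : Set N)

/-- The lattice `M(σ)` (without tensoring by `ℚ`): the elements of `M = Hom(N, ℤ)` that vanish
on `N_σ`, that is, the dual of `N(σ) = N / N_σ`. -/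
def dualLattice (σ : PointedCone ℚ (NQ N)) : Submodule ℤ (Module.Dual ℤ N) :=
  (subLattice σ).dualAnnihilator

/-- The pairing of `M(σ)_ℚ` with an element of `N(σ) = N / N_σ`. -/
def pairing (σ : PointedCone ℚ (NQ N)) (u : N ⧸ subLattice σ) : perp σ →ₗ[ℚ] ℚ where
  toFun m := (subLattice σ).liftQ
    ((m.1.restrictScalars ℤ).comp (TensorProduct.mk ℤ ℚ N 1)) (by
      rw [subLattice, Submodule.span_le]
      intro v hv
      exact mem_perp m.2 hv) u
  map_add' m m' := by
    induction u using Submodule.Quotient.induction_on with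
    | H v => rfl
  map_smul' c m := by
    induction u using Submodule.Quotient.induction_on with
    | H v => rfl

lemma pairing_mk (σ : PointedCone ℚ (NQ N)) (v : N) (m : perp σ) :
    pairing σ (Submodule.Quotient.mk v) m = m.1 ((1 : ℚ) ⊗ₜ[ℤ] v) := rfl

/-- `u ∈ N(σ)` generates the monoid of lattice points of the image of `τ` in `N(σ)`. If `σ` is a
facet of `τ` (polyhedral, strongly convex), that image is a ray, and `u` exists and is unique:
it is the first lattice point of `N(σ)` along this ray. -/
def IsNormalGenerator (σ τ : PointedCone ℚ (NQ N)) (u : N ⧸ subLattice σ) : Prop :=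
  (latticePoints τ).map (subLattice σ).mkQ = AddSubmonoid.multiples u

/-- The vector `n_{τ,σ} ∈ N(σ)`, for a facet `σ` of `τ`. -/
def normalGenerator (σ τ : PointedCone ℚ (NQ N)) : N ⧸ subLattice σ :=
  if h : ∃ u, IsNormalGenerator σ τ u then h.choose else 0

lemma normalGenerator_lift (σ τ : PointedCone ℚ (NQ N)) :
    ∃ v ∈ latticePoints τ, Submodule.Quotient.mk v = normalGenerator σ τ := by
  unfold normalGenerator
  split_ifs with h
  · have h1 : h.choose ∈ (latticePoints τ).map (subLattice σ).mkQ := by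
      rw [h.choose_spec]
      exact AddSubmonoid.mem_multiples _
    obtain ⟨v, hv, hv'⟩ := h1
    exact ⟨v, hv, hv'⟩
  · exact ⟨0, zero_mem _, rfl⟩

/-- `M(σ)_τ = M(σ) / M(τ)` (tensored by `ℚ`), for `σ` a face of `τ`. -/
abbrev relQuot (σ τ : PointedCone ℚ (NQ N)) : Type _ :=
  perp σ ⧸ (perp τ).submoduleOf (perp σ)

/-- The pairing `⟨·, n_{τ,σ}⟩` on `M(σ)_τ`. -/
def pairNormal (σ τ : PointedCone ℚ (NQ N)) : relQuot σ τ →ₗ[ℚ] ℚ :=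
  ((perp τ).submoduleOf (perp σ)).liftQ (pairing σ (normalGenerator σ τ)) (by
    intro m hm
    obtain ⟨v, hv, hu⟩ := normalGenerator_lift σ τ
    rw [LinearMap.mem_ker, ← hu, pairing_mk]
    exact mem_perp hm hv)

end Cones

section Divisors

variable {N : Type*} [AddCommGroup N]

/-- A choice of complements for a fan. -/
structure Complements (F : Fan N) where
  toFun : F.cones → Submodule ℚ (MQ N)
  isCompl : ∀ σ : F.cones, IsCompl (perp σ.1) (toFun σ)
  mono : ∀ τ σ : F.cones, τ.1.IsFaceOf σ.1 → toFun τ ≤ toFun σ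

/-- A (torus-equivariant) `ℚ`-Cartier divisor on `X(F)`, given by its local equations
`m_σ ∈ M_σ = M / M(σ)` (tensored by `ℚ`). -/
structure QCartier (F : Fan N) where
  eqn : (σ : F.cones) → MQ N ⧸ perp σ.1
  compat : ∀ (τ σ : F.cones) (h : τ.1.IsFaceOf σ.1),
    Submodule.factor (perp_anti h.le) (eqn σ) = eqn τ

/-- Invariant cycles with rational coefficients: the `ℚ`-vector space on the symbols `[V(σ)]`. -/
abbrev Cycle (F : Fan N) : Type _ := F.cones →₀ ℚ

/-- The cycle `[V(σ)]`. -/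
def orbitClosure (F : Fan N) (σ : F.cones) : Cycle F := Finsupp.single σ 1

/-- `π_σ : M → M(σ)`, the projection along `Ψ(σ)`. -/
def Complements.proj {F : Fan N} (Ψ : Complements F) (σ : F.cones) : MQ N →ₗ[ℚ] perp σ.1 :=
  Submodule.projectionOnto _ _ (Ψ.isCompl σ)

/-- The induced map `π_σ : M_τ → M(σ)_τ`, for `σ ⊆ τ`. -/
def Complements.projQuot {F : Fan N} (Ψ : Complements F) (σ τ : F.cones) (h : σ.1 ≤ τ.1) :
    (MQ N ⧸ perp τ.1) →ₗ[ℚ] relQuot σ.1 τ.1 :=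
  Submodule.mapQ _ _ (Ψ.proj σ) (by
    intro m hm
    have h1 : Ψ.proj σ m = ⟨m, perp_anti h hm⟩ :=
      Submodule.projectionOnto_apply_left (Ψ.isCompl σ) ⟨m, perp_anti h hm⟩
    rw [Submodule.mem_comap, h1]
    exact hm)

/-- The action of a `ℚ`-Cartier divisor on invariant cycles:
`D · [V(σ)] = ∑_{τ → σ} ⟨π_σ(m_τ), n_{τ,σ}⟩ [V(τ)]`, extended linearly. -/
def act {F : Fan N} (Ψ : Complements F) (D : QCartier F) : Cycle F →ₗ[ℚ] Cycle F :=
  Finsupp.linearCombination ℚ fun σ : F.cones =>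
    ∑ τ : {τ : F.cones // IsFacet σ.1 τ.1},
      pairNormal σ.1 τ.1.1 (Ψ.projQuot σ τ.1 τ.2.1.le (D.eqn τ.1)) • orbitClosure F τ.1

end Divisors

section Maps

variable {N' N : Type*} [AddCommGroup N'] [AddCommGroup N]

/-- A map of fans (equivalently, a toric map). -/
structure FanHom (F' : Fan N') (F : Fan N) where
  toLin : N' →ₗ[ℤ] N
  map_cone : ∀ σ' ∈ F'.cones, ∃ σ ∈ F.cones, PointedCone.map (toLin.baseChange ℚ) σ' ≤ σ

variable {F' : Fan N'} {F : Fan N}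

/-- `φ_ℚ : N'_ℚ → N_ℚ`. -/
def FanHom.lin (φ : FanHom F' F) : NQ N' →ₗ[ℚ] NQ N := φ.toLin.baseChange ℚ

/-- `φ^* : M_ℚ → M'_ℚ`. -/
def FanHom.dual (φ : FanHom F' F) : MQ N →ₗ[ℚ] MQ N' := φ.lin.dualMap

/-- The support of a fan. -/
def Fan.support (F : Fan N) : Set (NQ N) := {x | ∃ σ ∈ F.cones, x ∈ σ}

/-- The map of fans is proper: `φ⁻¹(|F|) = |F'|`. -/
def FanHom.IsProper (φ : FanHom F' F) : Prop := φ.lin ⁻¹' F.support = F'.support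

/-- The cones of `F` that contain `φ(σ')`. -/
def FanHom.containing (φ : FanHom F' F) (σ' : F'.cones) : Finset (PointedCone ℚ (NQ N)) :=
  F.cones.filter fun σ => PointedCone.map φ.lin σ'.1 ≤ σ

lemma FanHom.containing_nonempty (φ : FanHom F' F) (σ' : F'.cones) :
    (φ.containing σ').Nonempty := by
  obtain ⟨σ, hσ, h⟩ := φ.map_cone σ'.1 σ'.2
  exact ⟨σ, Finset.mem_filter.2 ⟨hσ, h⟩⟩

/-- The smallest cone of `F` that contains `φ(σ')`: the intersection of all those that do. -/
def FanHom.minCone (φ : FanHom F' F) (σ' : F'.cones) : F.cones :=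
  ⟨(φ.containing σ').inf' (φ.containing_nonempty σ') id,
    Finset.inf'_induction (φ.containing_nonempty σ') id (p := fun σ => σ ∈ F.cones)
      (fun a ha b hb => F.face_mem a ha _ (F.inf_face a ha b hb).1)
      (fun _ hσ => (Finset.mem_filter.1 hσ).1)⟩

lemma FanHom.map_le_minCone (φ : FanHom F' F) (σ' : F'.cones) :
    PointedCone.map φ.lin σ'.1 ≤ (φ.minCone σ').1 :=
  Finset.le_inf' (φ.containing_nonempty σ') id fun _ hσ => (Finset.mem_filter.1 hσ).2

lemma FanHom.minCone_le (φ : FanHom F' F) (σ' : F'.cones) (σ : F.cones)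
    (h : PointedCone.map φ.lin σ'.1 ≤ σ.1) : (φ.minCone σ').1 ≤ σ.1 :=
  Finset.inf'_le (s := φ.containing σ') id (Finset.mem_filter.2 ⟨σ.2, h⟩)

lemma FanHom.minCone_isFaceOf (φ : FanHom F' F) {τ' σ' : F'.cones} (h : τ'.1 ≤ σ'.1) :
    (φ.minCone τ').1.IsFaceOf (φ.minCone σ').1 := by
  have h1 : (φ.minCone τ').1 ≤ (φ.minCone σ').1 :=
    φ.minCone_le τ' _ ((Submodule.map_mono h).trans (φ.map_le_minCone σ'))
  have h2 := (F.inf_face _ (φ.minCone τ').2 _ (φ.minCone σ').2).2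
  rwa [inf_eq_left.2 h1] at h2

/-- `φ^* (M(σ)) ⊆ M'(σ')` whenever `φ(σ') ⊆ σ`. -/
lemma FanHom.perp_le_comap (φ : FanHom F' F) {σ' : PointedCone ℚ (NQ N')}
    {σ : PointedCone ℚ (NQ N)} (h : PointedCone.map φ.lin σ' ≤ σ) :
    perp σ ≤ (perp σ').comap φ.dual := by
  intro m hm
  rw [Submodule.mem_comap, perp, Submodule.mem_dualAnnihilator]
  intro x hx
  induction hx using Submodule.span_induction with
  | mem x hx => exact mem_perp hm (h ⟨x, hx, rfl⟩)
  | zero => simp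
  | add x y _ _ hx hy => rw [map_add, hx, hy, add_zero]
  | smul a x _ hx => rw [map_smul, hx, smul_zero]

/-- The pullback `f^*(D)`: its local equation on `σ'` is `φ^*(m_σ)`, where `σ` is the smallest cone
containing `φ(σ')` (by the agreement conditions any cone containing `φ(σ')` gives the same). -/
def FanHom.pullback (φ : FanHom F' F) (D : QCartier F) : QCartier F' where
  eqn σ' := Submodule.mapQ _ _ φ.dual (φ.perp_le_comap (φ.map_le_minCone σ'))
    (D.eqn (φ.minCone σ'))
  compat τ' σ' h := by
    rw [← D.compat _ _ (φ.minCone_isFaceOf h.le)]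
    induction D.eqn (φ.minCone σ') using Submodule.Quotient.induction_on with
    | H m => rfl

/-- The index `[M'(σ') : φ^*(M(σ))]` of lattices, where `σ` is the smallest cone containing
`φ(σ')`; it is `0` if the index is infinite (and then `V(σ')` has an image of smaller
dimension, if `σ` and `σ'` have the same codimension). -/
def FanHom.index (φ : FanHom F' F) (σ' : F'.cones) : ℕ :=
  ((dualLattice (φ.minCone σ').1).map φ.toLin.dualMap).toAddSubgroup.relIndex
    (dualLattice σ'.1).toAddSubgroup

/-- The push forward `f_*` of invariant cycles. -/
def FanHom.pushforward (φ : FanHom F' F) : Cycle F' →ₗ[ℚ] Cycle F :=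
  Finsupp.linearCombination ℚ fun σ' : F'.cones =>
    if codim (φ.minCone σ').1 = codim σ'.1 then
      (φ.index σ' : ℚ) • orbitClosure F (φ.minCone σ') else 0

/-- `f_*` takes invariant cycles to invariant cycles: the smallest cone containing `φ(σ')` never
has larger codimension than `σ'`, so that the recipe for `f_*` covers every `σ'`. This holds in
particular when `φ_ℚ` is surjective. -/
def FanHom.PreservesInvariant (φ : FanHom F' F) : Prop :=
  ∀ σ' : F'.cones, codim (φ.minCone σ').1 ≤ codim σ'.1

/-- The compatibility of the choices of complements `Ψ'` and `Ψ`. -/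
def FanHom.Compatible (φ : FanHom F' F) (Ψ' : Complements F') (Ψ : Complements F) : Prop :=
  ∀ (σ' : F'.cones) (σ : F.cones), PointedCone.map φ.lin σ'.1 ≤ σ.1 → codim σ'.1 = codim σ.1 →
    (Ψ.toFun σ).map φ.dual ≤ Ψ'.toFun σ'

end Maps

end ToricCycles

end

/-! Write c(σ') for the smallest cone containing φ(σ'). In f_*(f^*(D)·[V(σ')]) only those τ' → σ'
survive for which c(τ') has the codimension of τ', each weighted by its lattice index. Two cases
remain, according to whether c(σ') has the codimension of σ' or a smaller one.

Equal codimension. Each surviving c(τ') has c(σ') as a facet; φ sends n_{τ',σ'} to a·n_{c(τ'),c(σ')}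
with a > 0, and the index of σ' is a times that of τ' (`FanHom.exists_index_eq`). Compatible
complements make the projections commute with φ^*, so matching terms agree
(`FanHom.Compatible.actCoeff_mul_index`). If the index of σ' is 0, both sides vanish. Otherwise
N'(σ')_ℚ → N(c(σ'))_ℚ is an isomorphism: properness produces a τ' over every τ → c(σ')
(`FanHom.exists_facet_of_facet`), and injectivity makes it unique (`FanHom.eq_of_minCone_eq`).

Smaller codimension. The right side is 0, and every surviving τ' has c(τ') = c(σ'). If some
surviving τ₁ has nonzero index, the kernel of N'(σ')_ℚ → N(c(σ'))_ℚ is the line through n_{τ₁,σ'}.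
Properness fills the opposite ray with a cone τ₂ (`FanHom.exists_opposite_facet`), and there is no
third (`FanHom.eq_or_eq_of_opposite`). The two have opposite normal generators, the same local
equation and the same index, so they cancel.

Properness enters through `FanHom.IsProper.exists_cone`: a short segment leaving the relative
interior of σ' starts out in a single cone having σ' as a face, provided its image lies in a cone.
This uses finiteness of the fan and closedness of polyhedral cones; over ℚ the latter comes from
Weyl's theorem. -/

namespace PointedCone

/-! ### Convex geometry: internal points, faces, extremal rays, Weyl's theorem. -/

variable {𝕜 V W : Type*} [Field 𝕜] [LinearOrder 𝕜] [IsStrictOrderedRing 𝕜]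
  [AddCommGroup V] [Module 𝕜 V] [AddCommGroup W] [Module 𝕜 W]

/-- `w` is an internal point of the cone `C`: it lies in the algebraic relative interior. -/
def IsInternal (C : PointedCone 𝕜 V) (w : V) : Prop :=
  w ∈ C ∧ ∀ s ∈ C, ∃ k : 𝕜, 0 ≤ k ∧ k • w - s ∈ C

/-- The sum of the generators works: subtracting one generator leaves the sum of the others. -/
theorem exists_isInternal {C : PointedCone 𝕜 V} (hC : C.FG) : ∃ w, C.IsInternal w := by
  obtain ⟨S, rfl⟩ := hC
  have hS : ∀ T ⊆ S, ∑ x ∈ T, x ∈ Submodule.span {c : 𝕜 // 0 ≤ c} (S : Set V) := fun T hT =>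
    Submodule.sum_mem _ fun x hx => Submodule.subset_span (hT hx)
  refine ⟨∑ x ∈ S, x, hS S subset_rfl, fun s hs => ?_⟩
  induction hs using Submodule.span_induction with
  | mem x hx =>
    refine ⟨1, zero_le_one, ?_⟩
    rw [one_smul, ← Finset.sum_erase_add _ _ (Finset.mem_coe.1 hx), add_sub_cancel_right]
    exact hS _ (Finset.erase_subset _ _)
  | zero => exact ⟨0, le_rfl, by simp⟩
  | add x y _ _ hx hy =>
    obtain ⟨k, hk, hx⟩ := hx
    obtain ⟨l, hl, hy⟩ := hy
    refine ⟨k + l, add_nonneg hk hl, ?_⟩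
    rw [add_smul, add_sub_add_comm]
    exact add_mem hx hy
  | smul a x _ hx =>
    obtain ⟨k, hk, hx⟩ := hx
    refine ⟨a.1 * k, mul_nonneg a.2 hk, ?_⟩
    have := Submodule.smul_mem _ a hx
    rwa [smul_sub, ← smul_assoc] at this

theorem exists_sub_eq_of_mem_span {C : PointedCone 𝕜 V} {s : V}
    (hs : s ∈ Submodule.span 𝕜 (C : Set V)) : ∃ a ∈ C, ∃ b ∈ C, s = a - b := by
  induction hs using Submodule.span_induction with
  | mem x hx => exact ⟨x, hx, 0, zero_mem _, by simp⟩
  | zero => exact ⟨0, zero_mem _, 0, zero_mem _, by simp⟩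
  | add x y _ _ hx hy =>
    obtain ⟨a, ha, b, hb, rfl⟩ := hx
    obtain ⟨c, hc, d, hd, rfl⟩ := hy
    exact ⟨a + c, add_mem ha hc, b + d, add_mem hb hd, by abel⟩
  | smul t x _ hx =>
    obtain ⟨a, ha, b, hb, rfl⟩ := hx
    rcases le_total 0 t with ht | ht
    · exact ⟨t • a, C.smul_mem ht ha, t • b, C.smul_mem ht hb, smul_sub _ _ _⟩
    · refine ⟨(-t) • b, C.smul_mem (neg_nonneg.2 ht) hb, (-t) • a,
        C.smul_mem (neg_nonneg.2 ht) ha, ?_⟩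
      module

/-- A positive multiple of an internal point absorbs every vector of the linear span. -/
theorem IsInternal.exists_add_mem {C : PointedCone 𝕜 V} {w : V} (hw : C.IsInternal w) {s : V}
    (hs : s ∈ Submodule.span 𝕜 (C : Set V)) : ∃ k : 𝕜, 0 < k ∧ s + k • w ∈ C := by
  obtain ⟨a, ha, b, hb, rfl⟩ := exists_sub_eq_of_mem_span hs
  obtain ⟨k, hk, h⟩ := hw.2 b hb
  refine ⟨k + 1, by positivity, ?_⟩
  have := add_mem (add_mem ha h) hw.1
  convert this using 1
  module

theorem IsInternal.add_mem_of_le {C : PointedCone 𝕜 V} {w s : V} (hw : C.IsInternal w) {k l : 𝕜}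
    (h : s + k • w ∈ C) (hkl : k ≤ l) : s + l • w ∈ C := by
  have := add_mem h (C.smul_mem (sub_nonneg.2 hkl) hw.1)
  convert this using 1
  module

/-- If t = a - b with a, b in the face, then t + b lies in the face, hence so does its summand t. -/
theorem IsFaceOf.mem_of_mem_span {F C : PointedCone 𝕜 V} (hF : F.IsFaceOf C) {t : V} (ht : t ∈ C)
    (h : t ∈ Submodule.span 𝕜 (F : Set V)) : t ∈ F := by
  obtain ⟨a, ha, b, hb, rfl⟩ := exists_sub_eq_of_mem_span h
  exact hF.mem_of_add_mem_left ht (hF.le hb) (by simpa using ha)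

theorem IsFaceOf.eq_of_span_le {F C : PointedCone 𝕜 V} (hF : F.IsFaceOf C)
    (h : Submodule.span 𝕜 (C : Set V) ≤ Submodule.span 𝕜 (F : Set V)) : F = C :=
  le_antisymm hF.le fun _ hx => hF.mem_of_mem_span hx (h (Submodule.subset_span hx))

/-- The smallest face of a cone that contains a given point of it. -/
def minFace (C : PointedCone 𝕜 V) (x : V) (hx : x ∈ C) : PointedCone 𝕜 V where
  carrier := {s | s ∈ C ∧ ∃ k : 𝕜, 0 ≤ k ∧ k • x - s ∈ C}
  zero_mem' := ⟨zero_mem _, 1, zero_le_one, by simpa using hx⟩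
  add_mem' := by
    rintro a b ⟨ha, k, hk, hka⟩ ⟨hb, l, hl, hlb⟩
    refine ⟨add_mem ha hb, k + l, add_nonneg hk hl, ?_⟩
    rw [add_smul, add_sub_add_comm]
    exact add_mem hka hlb
  smul_mem' := by
    rintro c a ⟨ha, k, hk, hka⟩
    refine ⟨Submodule.smul_mem _ c ha, c.1 * k, mul_nonneg c.2 hk, ?_⟩
    have := Submodule.smul_mem _ c hka
    rwa [smul_sub, ← smul_assoc] at this

theorem minFace_isFaceOf (C : PointedCone 𝕜 V) (x : V) (hx : x ∈ C) :
    (C.minFace x hx).IsFaceOf C := by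
  refine IsFaceOf.of_mem_of_add_mem_left (fun s hs => hs.1) ?_
  rintro a b ha hb ⟨-, k, hk, h⟩
  refine ⟨ha, k, hk, ?_⟩
  convert add_mem h hb using 1
  abel

theorem minFace_isInternal (C : PointedCone 𝕜 V) (x : V) (hx : x ∈ C) :
    (C.minFace x hx).IsInternal x := by
  refine ⟨⟨hx, 1, zero_le_one, by simp⟩, ?_⟩
  rintro s ⟨hs, k, hk, h⟩
  exact ⟨k, hk, h, k, hk, by simpa using hs⟩

/-- A multiple of w is s plus another element of D, so a face containing w contains each s in D. -/
theorem IsInternal.le_of_mem_face {C D F : PointedCone 𝕜 V} {w : V} (hw : D.IsInternal w)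
    (hD : D ≤ C) (hF : F.IsFaceOf C) (h : w ∈ F) : D ≤ F := by
  intro s hs
  obtain ⟨k, hk, hks⟩ := hw.2 s hs
  refine hF.mem_of_add_mem_left (hD hs) (hD hks) ?_
  simpa using F.smul_mem hk h

theorem IsInternal.map {C : PointedCone 𝕜 V} {w : V} (hw : C.IsInternal w) (f : V →ₗ[𝕜] W) :
    (C.map f).IsInternal (f w) := by
  refine ⟨⟨w, hw.1, rfl⟩, ?_⟩
  rintro _ ⟨s, hs, rfl⟩
  obtain ⟨k, hk, h⟩ := hw.2 s hs
  exact ⟨k, hk, _, h, by simp⟩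

/-- A nonzero finitely generated salient cone has an extremal ray. -/
theorem exists_ray_isFaceOf {C : PointedCone 𝕜 V} (hC : C.FG)
    (hs : ∀ x ∈ C, -x ∈ C → x = 0) (h0 : C ≠ ⊥) :
    ∃ g ∈ C, g ≠ 0 ∧ (hull 𝕜 {g}).IsFaceOf C := by
  -- In a generating set of minimal cardinality no generator is redundant, and each one spans an
  -- extremal ray.
  obtain ⟨S, hS, hmin⟩ : ∃ S : Finset V, hull 𝕜 (S : Set V) = C ∧
      ∀ T : Finset V, hull 𝕜 (T : Set V) = C → S.card ≤ T.card := by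
    have hex : ∃ n, ∃ S : Finset V, hull 𝕜 (S : Set V) = C ∧ S.card = n := by
      obtain ⟨S, h⟩ := hC
      exact ⟨_, S, h, rfl⟩
    obtain ⟨S, h1, h2⟩ := Nat.find_spec hex
    exact ⟨S, h1, fun T hT => h2 ▸ Nat.find_min' hex ⟨T, hT, rfl⟩⟩
  have hne : S.Nonempty := by
    rw [Finset.nonempty_iff_ne_empty]
    rintro rfl
    exact h0 (by simp [← hS])
  obtain ⟨g, hg⟩ := hne
  have hgS : g ∉ hull 𝕜 ((S.erase g : Finset V) : Set V) := by
    intro h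
    have : hull 𝕜 ((S.erase g : Finset V) : Set V) = C := by
      refine le_antisymm (hS ▸ Submodule.span_mono (by simp)) ?_
      rw [← hS]
      refine Submodule.span_le.2 fun x hx => ?_
      rcases eq_or_ne x g with rfl | hxg
      · exact h
      · exact Submodule.subset_span (by simpa [hxg] using hx)
    have h1 := hmin _ this
    have h2 := Finset.card_erase_lt_of_mem hg
    omega
  have hgC : g ∈ C := hS ▸ Submodule.subset_span hg
  have hdec : ∀ x ∈ C, ∃ a : 𝕜, 0 ≤ a ∧ ∃ y ∈ hull 𝕜 ((S.erase g : Finset V) : Set V),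
      x = a • g + y := by
    intro x hx
    rw [← hS, ← Finset.insert_erase hg, Finset.coe_insert, Submodule.mem_span_insert] at hx
    obtain ⟨a, y, hy, rfl⟩ := hx
    exact ⟨a.1, a.2, y, hy, rfl⟩
  have hle : hull 𝕜 ((S.erase g : Finset V) : Set V) ≤ C := hS ▸ Submodule.span_mono (by simp)
  refine ⟨g, hgC, fun h => hgS (h ▸ zero_mem _), ?_⟩
  refine IsFaceOf.of_mem_of_add_mem_left ?_ ?_
  · exact Submodule.span_le.2 (by simpa using hgC)
  · intro x y hx hy hxy
    obtain ⟨c, hc⟩ := Submodule.mem_span_singleton.1 hxy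
    obtain ⟨a, ha, x1, hx1, rfl⟩ := hdec x hx
    obtain ⟨b, hb, y1, hy1, rfl⟩ := hdec y hy
    have hc' : (c.1 - a - b) • g = x1 + y1 := by
      have : c.1 • g = a • g + x1 + (b • g + y1) := hc
      rw [sub_smul, sub_smul, this]
      abel
    -- A positive coefficient would express g through the other generators; a nonpositive one
    -- exhibits -x1 as an element of C, and salience gives x1 = 0.
    have hle' : c.1 - a - b ≤ 0 := by
      by_contra! h
      refine hgS ?_
      rw [← PointedCone.smul_mem_iff _ h, hc']
      exact add_mem hx1 hy1
    have hx0 : x1 = 0 := by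
      refine hs x1 (hle hx1) ?_
      have : -x1 = (-(c.1 - a - b)) • g + y1 := by
        rw [neg_smul, hc']
        abel
      rw [this]
      exact add_mem (C.smul_mem (neg_nonneg.2 hle') hgC) (hle hy1)
    rw [hx0, add_zero]
    exact Submodule.mem_span_singleton.2 ⟨⟨a, ha⟩, rfl⟩

/-- A finitely generated cone is a ray modulo the span of any of its maximal proper faces. -/
theorem IsFaceOf.exists_ray_of_maximal {F C : PointedCone 𝕜 V} (hC : C.FG) (hF : F.IsFaceOf C)
    (hne : F ≠ C) (hmax : ∀ G : PointedCone 𝕜 V, G.IsFaceOf C → F ≤ G → G = F ∨ G = C) :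
    ∃ g ∈ C, g ∉ Submodule.span 𝕜 (F : Set V) ∧
      ∀ x ∈ C, ∃ a : 𝕜, 0 ≤ a ∧ x - a • g ∈ Submodule.span 𝕜 (F : Set V) := by
  set U := Submodule.span 𝕜 (F : Set V)
  -- Because F is a face, C modulo the span of F is again salient, so the quotient cone has an
  -- extremal ray.
  have hsal : ∀ x ∈ C.map U.mkQ, -x ∈ C.map U.mkQ → x = 0 := by
    rintro _ ⟨x, hx, rfl⟩ ⟨y, hy, hxy⟩
    have hxy' : x + y ∈ U := by
      rw [← Submodule.Quotient.mk_eq_zero, Submodule.Quotient.mk_add]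
      have : U.mkQ y = -U.mkQ x := hxy
      exact add_eq_zero_iff_neg_eq.2 this.symm
    have := hF.mem_of_add_mem_left hx hy (hF.mem_of_mem_span (add_mem hx hy) hxy')
    exact (Submodule.Quotient.mk_eq_zero U).2 (Submodule.subset_span this)
  have hbot : C.map U.mkQ ≠ ⊥ := by
    intro h
    refine hne (le_antisymm hF.le fun x hx => hF.mem_of_mem_span hx ?_)
    have : U.mkQ x ∈ C.map U.mkQ := ⟨x, hx, rfl⟩
    rw [h] at this
    exact (Submodule.Quotient.mk_eq_zero U).1 this
  obtain ⟨_, ⟨g, hg, rfl⟩, hg0, hray⟩ := exists_ray_isFaceOf (Submodule.FG.map _ hC) hsal hbot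
  have hgU : g ∉ U := fun h => hg0 ((Submodule.Quotient.mk_eq_zero U).2 h)
  refine ⟨g, hg, hgU, ?_⟩
  -- The preimage of the extremal ray is a face strictly larger than F; maximality of F makes it all
  -- of C.
  have hface : (C ⊓ (hull 𝕜 {U.mkQ g}).comap U.mkQ).IsFaceOf C := by
    refine IsFaceOf.of_mem_of_add_mem_left inf_le_left ?_
    rintro x y hx hy ⟨-, h⟩
    refine ⟨hx, ?_⟩
    exact hray.mem_of_add_mem_left (y := U.mkQ y) ⟨x, hx, rfl⟩ ⟨y, hy, rfl⟩ h
  rcases hmax _ hface (fun x hx => ⟨hF.le hx, by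
      have : U.mkQ x = 0 := (Submodule.Quotient.mk_eq_zero U).2 (Submodule.subset_span hx)
      change U.mkQ x ∈ hull 𝕜 {U.mkQ g}
      rw [this]
      exact zero_mem _⟩) with h | h
  · have : g ∈ C ⊓ (hull 𝕜 {U.mkQ g}).comap U.mkQ :=
      ⟨hg, Submodule.mem_span_singleton_self _⟩
    rw [h] at this
    exact absurd (Submodule.subset_span this) hgU
  · intro x hx
    rw [← h] at hx
    obtain ⟨a, ha⟩ := Submodule.mem_span_singleton.1 hx.2
    refine ⟨a.1, a.2, ?_⟩
    rw [← Submodule.Quotient.mk_eq_zero, Submodule.Quotient.mk_sub, sub_eq_zero]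
    exact ha.symm

/-- Fourier-Motzkin elimination of one generator. -/
theorem exists_finset_dual_sup_span_singleton {C : PointedCone 𝕜 V}
    (S : Finset (Module.Dual 𝕜 V)) (hS : ∀ x, x ∈ C ↔ ∀ f ∈ S, 0 ≤ f x) (g : V) :
    ∃ T : Finset (Module.Dual 𝕜 V), ∀ x, x ∈ hull 𝕜 {g} ⊔ C ↔ ∀ f ∈ T, 0 ≤ f x := by
  have hmem : ∀ x, x ∈ hull 𝕜 {g} ⊔ C ↔ ∃ t : 𝕜, 0 ≤ t ∧ ∀ f ∈ S, t * f g ≤ f x := by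
    intro x
    constructor
    · intro hx
      obtain ⟨y, hy, z, hz, rfl⟩ := Submodule.mem_sup.1 hx
      obtain ⟨t, rfl⟩ := Submodule.mem_span_singleton.1 hy
      refine ⟨t.1, t.2, fun f hf => ?_⟩
      have h1 : f (t • g) = t.1 * f g := f.map_smul t.1 g
      rw [map_add, h1]
      exact le_add_of_nonneg_right ((hS z).1 hz f hf)
    · rintro ⟨t, ht, h⟩
      refine Submodule.mem_sup.2 ⟨t • g, Submodule.mem_span_singleton.2 ⟨⟨t, ht⟩, rfl⟩,
        x - t • g, (hS _).2 fun f hf => ?_, by abel⟩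
      rw [map_sub, map_smul, smul_eq_mul]
      exact sub_nonneg.2 (h f hf)
  -- Each f with f g < 0 bounds t below by f x / f g, each f with f g > 0 bounds it above. A common
  -- t ≥ 0 exists iff every lower bound, including 0, is at most every upper bound; the new
  -- functionals express this.
  refine ⟨S.filter (fun f => 0 ≤ f g) ∪
    ((S.filter fun f => f g < 0) ×ˢ (S.filter fun f => 0 < f g)).image
      (fun p => p.2 g • p.1 - p.1 g • p.2), fun x => ?_⟩
  rw [hmem]
  constructor
  · rintro ⟨t, ht, h⟩ f hf
    rcases Finset.mem_union.1 hf with hf | hf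
    · obtain ⟨hf, hfg⟩ := Finset.mem_filter.1 hf
      exact (mul_nonneg ht hfg).trans (h f hf)
    · obtain ⟨⟨p, q⟩, hpq, rfl⟩ := Finset.mem_image.1 hf
      obtain ⟨hp, hq⟩ := Finset.mem_product.1 hpq
      obtain ⟨hp, hpg⟩ := Finset.mem_filter.1 hp
      obtain ⟨hq, hqg⟩ := Finset.mem_filter.1 hq
      dsimp only at hp hq hpg hqg
      have h1 := mul_le_mul_of_nonneg_left (h p hp) hqg.le
      have h2 := mul_le_mul_of_nonpos_left (h q hq) hpg.le
      simp only [LinearMap.sub_apply, LinearMap.smul_apply, smul_eq_mul]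
      linarith [mul_comm (q g) (t * p g), mul_comm (p g) (t * q g), mul_right_comm t (p g) (q g)]
  · intro h
    have h1 : ∀ f ∈ S, 0 ≤ f g → 0 ≤ f x := fun f hf hfg =>
      h f (Finset.mem_union_left _ (Finset.mem_filter.2 ⟨hf, hfg⟩))
    have h2 : ∀ p ∈ S, ∀ q ∈ S, p g < 0 → 0 < q g → p g * q x ≤ q g * p x := by
      intro p hp q hq hpg hqg
      have := h _ (Finset.mem_union_right _ (Finset.mem_image_of_mem _ (Finset.mem_product.2
        ⟨Finset.mem_filter.2 ⟨hp, hpg⟩, Finset.mem_filter.2 ⟨hq, hqg⟩⟩ :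
          (p, q) ∈ (S.filter fun f => f g < 0) ×ˢ (S.filter fun f => 0 < f g))))
      simpa using this
    -- The lower bounds on t; their maximum is the witness.
    set B : Finset 𝕜 := insert 0 ((S.filter fun f => f g < 0).image fun f => f x / f g) with hB
    have hBne : B.Nonempty := Finset.insert_nonempty _ _
    refine ⟨B.max' hBne, Finset.le_max' _ _ (Finset.mem_insert_self _ _), fun f hf => ?_⟩
    rcases lt_trichotomy (f g) 0 with hfg | hfg | hfg
    · rw [← div_le_iff_of_neg hfg]
      exact Finset.le_max' _ _ (Finset.mem_insert_of_mem
        (Finset.mem_image_of_mem (fun f : Module.Dual 𝕜 V => f x / f g)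
          (Finset.mem_filter.2 ⟨hf, hfg⟩)))
    · rw [hfg, mul_zero]
      exact h1 f hf hfg.ge
    · rw [← le_div_iff₀ hfg]
      refine Finset.max'_le _ _ _ fun b hb => ?_
      rcases Finset.mem_insert.1 hb with rfl | hb
      · exact div_nonneg (h1 f hf hfg.le) hfg.le
      · obtain ⟨p, hp, rfl⟩ := Finset.mem_image.1 hb
        obtain ⟨hp, hpg⟩ := Finset.mem_filter.1 hp
        rw [le_div_iff₀ hfg, div_mul_eq_mul_div, div_le_iff_of_neg hpg]
        linarith [h2 p hp f hf hpg hfg, mul_comm (p g) (f x), mul_comm (f g) (p x)]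

/-- **Weyl's theorem**: a finitely generated cone is an intersection of finitely many half-spaces. -/
theorem exists_finset_dual_of_fg [FiniteDimensional 𝕜 V] {C : PointedCone 𝕜 V} (hC : C.FG) :
    ∃ T : Finset (Module.Dual 𝕜 V), ∀ x, x ∈ C ↔ ∀ f ∈ T, 0 ≤ f x := by
  obtain ⟨S, rfl⟩ := hC
  induction S using Finset.induction_on with
  | empty =>
    let b := Module.finBasis 𝕜 V
    refine ⟨Finset.univ.image b.coord ∪ Finset.univ.image (fun i => -b.coord i), fun x => ?_⟩
    simp only [Finset.coe_empty, Submodule.span_empty, Submodule.mem_bot]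
    constructor
    · rintro rfl
      simp
    · intro h
      refine b.ext_elem fun i => ?_
      have h1 := h (b.coord i) (by simp)
      have h2 := h (-b.coord i) (by simp)
      simp only [LinearMap.neg_apply, Module.Basis.coord_apply] at h1 h2
      simp only [map_zero, Finsupp.coe_zero, Pi.zero_apply]
      linarith
  | insert g S _ ih =>
    obtain ⟨T, hT⟩ := ih
    rw [Finset.coe_insert, Submodule.span_insert]
    exact exists_finset_dual_sup_span_singleton T hT g

/-- Closedness along a segment, without topology: a defining functional negative at x stays negative
for all small ε. -/
theorem mem_of_forall_exists_add_smul_mem [FiniteDimensional 𝕜 V] {C : PointedCone 𝕜 V}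
    (hC : C.FG) {x v : V} (h : ∀ δ : 𝕜, 0 < δ → ∃ ε, 0 < ε ∧ ε < δ ∧ x + ε • v ∈ C) : x ∈ C := by
  obtain ⟨T, hT⟩ := exists_finset_dual_of_fg hC
  refine (hT x).2 fun f hf => ?_
  by_contra! hx
  obtain ⟨ε, hε, hlt, hmem⟩ := h (-f x / (|f v| + 1)) (by
    have := abs_nonneg (f v)
    exact div_pos (by linarith) (by linarith))
  have h1 := (hT _).1 hmem f hf
  rw [map_add, map_smul, smul_eq_mul] at h1
  rw [lt_div_iff₀ (by positivity)] at hlt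
  have h2 := mul_le_mul_of_nonneg_left (le_abs_self (f v)) hε.le
  linarith

end PointedCone

/-! ### Lattice points, normal generators, codimension and dual lattices. -/

namespace ToricCycles

section Lattice

variable {N : Type*} [AddCommGroup N]

/-- The canonical map `N → N_ℚ`. -/
def toNQ : N →ₗ[ℤ] NQ N := TensorProduct.mk ℤ ℚ N 1

theorem toNQ_apply (v : N) : toNQ v = (1 : ℚ) ⊗ₜ[ℤ] v := rfl

theorem mem_latticePoints {σ : PointedCone ℚ (NQ N)} {v : N} :
    v ∈ latticePoints σ ↔ toNQ v ∈ σ := Iff.rfl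

theorem toNQ_nsmul (n : ℕ) (v : N) : toNQ (n • v) = (n : ℚ) • toNQ v := by
  rw [map_nsmul, Nat.cast_smul_eq_nsmul]

theorem exists_nat_smul_eq_toNQ (x : NQ N) : ∃ n : ℕ, 0 < n ∧ ∃ v : N, (n : ℚ) • x = toNQ v := by
  induction x using TensorProduct.induction_on with
  | zero => exact ⟨1, one_pos, 0, by simp⟩
  | tmul q v =>
    refine ⟨q.den, q.den_pos, q.num • v, ?_⟩
    rw [TensorProduct.smul_tmul', smul_eq_mul, Rat.den_mul_eq_num, toNQ_apply,
      ← TensorProduct.smul_tmul, zsmul_eq_mul, mul_one]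
  | add x y hx hy =>
    obtain ⟨n, hn, v, hv⟩ := hx
    obtain ⟨k, hk, w, hw⟩ := hy
    refine ⟨n * k, Nat.mul_pos hn hk, k • v + n • w, ?_⟩
    rw [map_add, toNQ_nsmul, toNQ_nsmul, ← hv, ← hw]
    push_cast
    module

theorem smul_mem_nat {σ : PointedCone ℚ (NQ N)} {x : NQ N} {n : ℕ} (hn : 0 < n) :
    (n : ℚ) • x ∈ σ ↔ x ∈ σ :=
  PointedCone.smul_mem_iff σ (Nat.cast_pos.2 hn)

theorem exists_isInternal_toNQ {σ : PointedCone ℚ (NQ N)} (hσ : σ.FG) :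
    ∃ w : N, σ.IsInternal (toNQ w) := by
  obtain ⟨x, hx, h⟩ := PointedCone.exists_isInternal hσ
  obtain ⟨n, hn, v, hv⟩ := exists_nat_smul_eq_toNQ x
  have hn' : (0 : ℚ) < n := Nat.cast_pos.2 hn
  refine ⟨v, hv ▸ (smul_mem_nat hn).2 hx, fun s hs => ?_⟩
  obtain ⟨k, hk, hks⟩ := h s hs
  refine ⟨k / n, by positivity, ?_⟩
  rwa [← hv, smul_smul, div_mul_cancel₀ _ hn'.ne']

/-- Every vector of the span of a cone moves into the cone under a lattice translation. -/
theorem exists_lattice_translate {σ : PointedCone ℚ (NQ N)} {w : N}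
    (hw : σ.IsInternal (toNQ w)) {s : NQ N} (hs : s ∈ Submodule.span ℚ (σ : Set (NQ N))) :
    ∃ k : ℕ, s + toNQ (k • w) ∈ σ := by
  obtain ⟨k, hk, h⟩ := hw.exists_add_mem hs
  obtain ⟨n, hn⟩ := exists_nat_ge k
  exact ⟨n, by rw [toNQ_nsmul]; exact hw.add_mem_of_le h hn⟩

theorem subLattice_mono {σ τ : PointedCone ℚ (NQ N)} (h : σ ≤ τ) : subLattice σ ≤ subLattice τ :=
  Submodule.span_mono fun _ hv => h hv

theorem toNQ_mem_span_of_mem_subLattice {σ : PointedCone ℚ (NQ N)} {v : N}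
    (h : v ∈ subLattice σ) : toNQ v ∈ Submodule.span ℚ (σ : Set (NQ N)) := by
  induction h using Submodule.span_induction with
  | mem x hx => exact Submodule.subset_span hx
  | zero => simp
  | add x y _ _ hx hy => rw [map_add]; exact add_mem hx hy
  | smul a x _ hx => rw [map_zsmul]; exact zsmul_mem hx a

/-- `N_σ` is the set of all lattice points of the linear span of `σ`. -/
theorem mem_subLattice_iff {σ : PointedCone ℚ (NQ N)} (hσ : σ.FG) {v : N} :
    v ∈ subLattice σ ↔ toNQ v ∈ Submodule.span ℚ (σ : Set (NQ N)) := by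
  refine ⟨toNQ_mem_span_of_mem_subLattice, fun h => ?_⟩
  obtain ⟨w, hw⟩ := exists_isInternal_toNQ hσ
  obtain ⟨k, hk⟩ := exists_lattice_translate hw h
  rw [← map_add] at hk
  have hw' : w ∈ latticePoints σ := hw.1
  have := sub_mem (Submodule.subset_span (R := ℤ) (mem_latticePoints.2 hk))
    (Submodule.subset_span (R := ℤ) (nsmul_mem hw' k))
  rwa [add_sub_cancel_right] at this

/-- The rational functional defined by an integral one. -/
def rationalize (m : Module.Dual ℤ N) : MQ N :=
  LinearMap.liftBaseChange ℚ ((Algebra.linearMap ℤ ℚ).comp m)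

theorem rationalize_toNQ (m : Module.Dual ℤ N) (v : N) : rationalize m (toNQ v) = m v := by
  simp [rationalize, toNQ_apply]

theorem MQ_ext {f g : MQ N} (h : ∀ v : N, f (toNQ v) = g (toNQ v)) : f = g := by
  refine LinearMap.ext fun x => ?_
  obtain ⟨n, hn, v, hv⟩ := exists_nat_smul_eq_toNQ x
  have hn' : (n : ℚ) ≠ 0 := Nat.cast_ne_zero.2 hn.ne'
  refine smul_right_injective ℚ hn' ?_
  change (n : ℚ) • f x = (n : ℚ) • g x
  rw [← map_smul, ← map_smul, hv, h]

theorem exists_smul_eq_rationalize [Module.Free ℤ N] [Module.Finite ℤ N] (f : MQ N) :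
    ∃ d : ℕ, 0 < d ∧ ∃ m : Module.Dual ℤ N, (d : ℚ) • f = rationalize m := by
  let b := Module.finBasis ℤ N
  obtain ⟨c, hc⟩ := IsLocalization.exist_integer_multiples_of_finite (nonZeroDivisors ℤ)
    (S := ℚ) fun i => f (toNQ (b i))
  choose z hz using hc
  have hc0 : (c : ℤ) ≠ 0 := nonZeroDivisors.coe_ne_zero c
  -- The common denominator c may be negative; its sign is moved into the integral functional so
  -- that d is positive.
  refine ⟨(c : ℤ).natAbs, Int.natAbs_pos.2 hc0, (c : ℤ).sign • b.constr ℤ z, ?_⟩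
  have key : ∀ v : N, (c : ℤ) • f (toNQ v) = (b.constr ℤ z v : ℤ) := by
    have : (c : ℤ) • (f.restrictScalars ℤ).comp toNQ =
        (Algebra.linearMap ℤ ℚ).comp (b.constr ℤ z) := by
      refine b.ext fun i => ?_
      simpa using (hz i).symm
    intro v
    simpa using LinearMap.congr_fun this v
  refine MQ_ext fun v => ?_
  rw [rationalize_toNQ, LinearMap.smul_apply, LinearMap.smul_apply, smul_eq_mul, smul_eq_mul,
    Int.cast_mul, ← key, zsmul_eq_mul, ← mul_assoc, ← Int.cast_mul, Int.sign_mul_self,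
    ← Int.cast_natCast]

theorem rationalize_mem_perp {σ : PointedCone ℚ (NQ N)} {m : Module.Dual ℤ N} :
    rationalize m ∈ perp σ ↔ m ∈ dualLattice σ := by
  constructor
  · intro h
    refine (Submodule.mem_dualAnnihilator m).2 fun v hv => ?_
    have := (Submodule.mem_dualAnnihilator _).1 h _ (toNQ_mem_span_of_mem_subLattice hv)
    rw [rationalize_toNQ] at this
    exact_mod_cast this
  · intro h
    refine (Submodule.mem_dualAnnihilator _).2 fun x hx => ?_
    induction hx using Submodule.span_induction with
    | mem x hx =>
      obtain ⟨n, hn, v, hv⟩ := exists_nat_smul_eq_toNQ x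
      have hvσ : v ∈ latticePoints σ := by
        rw [mem_latticePoints, ← hv]
        exact (smul_mem_nat hn).2 hx
      have h1 := (Submodule.mem_dualAnnihilator m).1 h v (Submodule.subset_span hvσ)
      have h2 := rationalize_toNQ m v
      rw [← hv, map_smul, h1, Int.cast_zero, smul_eq_mul] at h2
      exact (mul_eq_zero.1 h2).resolve_left (Nat.cast_ne_zero.2 hn.ne')
    | zero => simp
    | add x y _ _ hx hy => rw [map_add, hx, hy, add_zero]
    | smul a x _ hx => rw [map_smul, hx, smul_zero]

theorem mem_span_of_perp {σ : PointedCone ℚ (NQ N)} {x : NQ N} (h : ∀ m ∈ perp σ, m x = 0) :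
    x ∈ Submodule.span ℚ (σ : Set (NQ N)) :=
  (Subspace.forall_mem_dualAnnihilator_apply_eq_zero_iff _ _).1 h

/-- Choose an integral functional l vanishing on σ and nonnegative on τ. A lattice point of τ at
which l takes the positive generator of l(N_τ) generates the image of τ ∩ N, because an element of
N_τ killed by l lies in N_σ. -/
theorem IsFacet.exists_isNormalGenerator [Module.Free ℤ N] [Module.Finite ℤ N]
    {σ τ : PointedCone ℚ (NQ N)} (h : IsFacet σ τ) (hσ : σ.FG) (hτ : τ.FG) :
    ∃ u, IsNormalGenerator σ τ u := by
  obtain ⟨g, hg, hgσ, hray⟩ := h.1.exists_ray_of_maximal hτ h.2.1 h.2.2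
  obtain ⟨f, hfg, hf⟩ := Submodule.exists_le_ker_of_notMem hgσ
  obtain ⟨d, hd, l, hl⟩ := exists_smul_eq_rationalize ((f g)⁻¹ • f)
  have hd' : (0 : ℚ) < d := Nat.cast_pos.2 hd
  have hlg : rationalize l g = d := by
    rw [← hl, LinearMap.smul_apply, LinearMap.smul_apply, smul_eq_mul, smul_eq_mul,
      inv_mul_cancel₀ hfg, mul_one]
  have hl0 : ∀ x ∈ Submodule.span ℚ (σ : Set (NQ N)), rationalize l x = 0 := by
    intro x hx
    have : f x = 0 := hf hx
    rw [← hl, LinearMap.smul_apply, LinearMap.smul_apply, this, smul_zero, smul_zero]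
  have hmod : ∀ x ∈ Submodule.span ℚ (τ : Set (NQ N)),
      x - (rationalize l x / d) • g ∈ Submodule.span ℚ (σ : Set (NQ N)) := by
    intro x hx
    induction hx using Submodule.span_induction with
    | mem x hx =>
      obtain ⟨a, -, ha⟩ := hray x hx
      have := hl0 _ ha
      rw [map_sub, map_smul, hlg, smul_eq_mul, sub_eq_zero] at this
      rwa [this, mul_div_cancel_right₀ _ hd'.ne']
    | zero => simp
    | add x y _ _ hx hy =>
      convert add_mem hx hy using 1
      rw [map_add]
      module
    | smul a x _ hx =>
      convert Submodule.smul_mem _ a hx using 1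
      rw [map_smul, smul_eq_mul]
      module
  have hpos : ∀ x ∈ τ, 0 ≤ rationalize l x := by
    intro x hx
    obtain ⟨a, ha0, ha⟩ := hray x hx
    have := hl0 _ ha
    rw [map_sub, map_smul, hlg, smul_eq_mul, sub_eq_zero] at this
    rw [this]
    positivity
  obtain ⟨e, he⟩ : ∃ e : ℕ, (subLattice τ).map l = Ideal.span {(e : ℤ)} := by
    obtain ⟨c, hc⟩ := (IsPrincipalIdealRing.principal ((subLattice τ).map l : Ideal ℤ)).principal
    exact ⟨c.natAbs, by rw [Int.span_natAbs]; exact hc⟩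
  obtain ⟨y, hy, hye⟩ : (e : ℤ) ∈ (subLattice τ).map l := by
    rw [he]; exact Ideal.mem_span_singleton_self _
  obtain ⟨w, hw⟩ := exists_isInternal_toNQ hσ
  -- y need not lie in τ. Its component along the span of σ is pushed into σ by adding multiples of
  -- w, which does not change l; its component along g is already a nonnegative multiple.
  obtain ⟨k, hk⟩ := exists_lattice_translate hw (hmod _ (toNQ_mem_span_of_mem_subLattice hy))
  have hwσ : w ∈ subLattice σ := Submodule.subset_span hw.1
  have hlw : l w = 0 := by
    have := hl0 _ (toNQ_mem_span_of_mem_subLattice hwσ)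
    rw [rationalize_toNQ] at this
    exact_mod_cast this
  have hv : y + k • w ∈ latticePoints τ := by
    rw [mem_latticePoints, map_add]
    have h1 : rationalize l (toNQ y) / d = e / d := by rw [rationalize_toNQ, hye, Int.cast_natCast]
    have := add_mem (h.1.le hk) (τ.smul_mem (show (0 : ℚ) ≤ e / d by positivity) hg)
    rw [h1] at this
    convert this using 1
    abel
  have hlv : l (y + k • w) = e := by rw [map_add, map_nsmul, hlw, smul_zero, add_zero, hye]
  refine ⟨Submodule.Quotient.mk (y + k • w), le_antisymm ?_ ?_⟩
  · rintro _ ⟨x, hx, rfl⟩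
    have hx' : x ∈ subLattice τ := Submodule.subset_span hx
    have hlx : l x ∈ Ideal.span {(e : ℤ)} := he ▸ Submodule.mem_map_of_mem hx'
    have hlx0 : 0 ≤ l x := by
      have := hpos _ hx
      rw [← toNQ_apply, rationalize_toNQ] at this
      exact_mod_cast this
    obtain ⟨c, hc⟩ : ∃ c : ℕ, l x = c * e := by
      obtain ⟨c, hc⟩ := Ideal.mem_span_singleton'.1 hlx
      refine ⟨c.natAbs, ?_⟩
      rw [← abs_of_nonneg hlx0, ← hc, abs_mul, Nat.abs_cast, Int.natCast_natAbs]
    refine AddSubmonoid.mem_multiples_iff _ _ |>.2 ⟨c, ?_⟩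
    rw [← Submodule.Quotient.mk_smul]
    refine Eq.symm ((Submodule.Quotient.eq _).2 ((mem_subLattice_iff hσ).2 ?_))
    have hz : x - c • (y + k • w) ∈ subLattice τ :=
      sub_mem hx' (nsmul_mem (Submodule.subset_span hv) c)
    have := hmod _ (toNQ_mem_span_of_mem_subLattice hz)
    have hl' : l (x - c • (y + k • w)) = 0 := by
      rw [map_sub, map_nsmul, hlv, hc, nsmul_eq_mul, sub_self]
    rwa [rationalize_toNQ, hl', Int.cast_zero, zero_div, zero_smul, sub_zero] at this
  · rintro _ ⟨c, rfl⟩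
    exact ⟨c • (y + k • w), nsmul_mem hv c, rfl⟩

/-- `v` is a lattice point of `τ` that represents `n_{τ,σ}`. -/
def IsNormalLift (σ τ : PointedCone ℚ (NQ N)) (v : N) : Prop :=
  v ∈ latticePoints τ ∧ Submodule.Quotient.mk v = normalGenerator σ τ

theorem exists_isNormalLift (σ τ : PointedCone ℚ (NQ N)) : ∃ v, IsNormalLift σ τ v :=
  normalGenerator_lift σ τ

section Codim

variable [Module.Finite ℤ N]

theorem codim_add_finrank (σ : PointedCone ℚ (NQ N)) :
    codim σ + Module.finrank ℚ (Submodule.span ℚ (σ : Set (NQ N))) = Module.finrank ℚ (NQ N) :=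
  Submodule.finrank_quotient_add_finrank _

theorem codim_anti {σ τ : PointedCone ℚ (NQ N)} (h : σ ≤ τ) : codim τ ≤ codim σ := by
  have h1 := codim_add_finrank σ
  have h2 := codim_add_finrank τ
  have h3 := Submodule.finrank_mono (R := ℚ) (Submodule.span_mono (R := ℚ)
    (show (σ : Set (NQ N)) ⊆ τ from h))
  omega

theorem span_eq_of_codim_eq {σ τ : PointedCone ℚ (NQ N)}
    (h : Submodule.span ℚ (σ : Set (NQ N)) ≤ Submodule.span ℚ (τ : Set (NQ N)))
    (hc : codim σ = codim τ) :
    Submodule.span ℚ (σ : Set (NQ N)) = Submodule.span ℚ (τ : Set (NQ N)) := by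
  have h1 := codim_add_finrank σ
  have h2 := codim_add_finrank τ
  exact Submodule.eq_of_le_of_finrank_eq h (by omega)

theorem eq_of_isFaceOf_of_codim_eq {σ τ : PointedCone ℚ (NQ N)} (h : σ.IsFaceOf τ)
    (hc : codim σ = codim τ) : σ = τ :=
  h.eq_of_span_le (span_eq_of_codim_eq (Submodule.span_mono h.le) hc).ge

/-- An intermediate face has the codimension of one of the two ends, and nested faces of equal
codimension coincide. -/
theorem isFacet_of_codim {σ τ : PointedCone ℚ (NQ N)} (h : σ.IsFaceOf τ) (hne : σ ≠ τ)
    (hc : codim σ ≤ codim τ + 1) : IsFacet σ τ := by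
  refine ⟨h, hne, fun ρ hρ hσρ => ?_⟩
  have hσρ' : σ.IsFaceOf ρ := (PointedCone.IsFaceOf.isFaceOf_iff_le h hρ).2 hσρ
  have h1 := codim_anti hσρ
  have h2 := codim_anti hρ.le
  by_cases h3 : codim ρ = codim τ
  · exact Or.inr (eq_of_isFaceOf_of_codim_eq hρ h3)
  · exact Or.inl (eq_of_isFaceOf_of_codim_eq hσρ' (by omega)).symm

end Codim

/-- N_σ is saturated, being all lattice points of a linear span; this is what makes N_τ a direct
summand of N below. -/
theorem isTorsionFree_quotient_subLattice {σ : PointedCone ℚ (NQ N)} (hσ : σ.FG) :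
    Module.IsTorsionFree ℤ (N ⧸ subLattice σ) := by
  refine .of_smul_eq_zero fun n x hx => ?_
  induction x using Submodule.Quotient.induction_on with
  | H v =>
    rw [or_iff_not_imp_left]
    intro hn
    rw [← Submodule.Quotient.mk_smul, Submodule.Quotient.mk_eq_zero, mem_subLattice_iff hσ,
      map_zsmul, ← Int.cast_smul_eq_zsmul ℚ] at hx
    rw [Submodule.Quotient.mk_eq_zero, mem_subLattice_iff hσ]
    exact (Submodule.smul_mem_iff _ (Int.cast_ne_zero.2 hn)).1 hx

section Facet

variable [Module.Free ℤ N] [Module.Finite ℤ N] {σ τ : PointedCone ℚ (NQ N)}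

theorem IsFacet.normalGenerator_spec (h : IsFacet σ τ) (hσ : σ.FG) (hτ : τ.FG) :
    IsNormalGenerator σ τ (normalGenerator σ τ) := by
  have hex := h.exists_isNormalGenerator hσ hτ
  rw [normalGenerator, dif_pos hex]
  exact hex.choose_spec

theorem IsFacet.exists_sub_nsmul_mem (h : IsFacet σ τ) (hσ : σ.FG) (hτ : τ.FG) {v : N}
    (hv : IsNormalLift σ τ v) {x : N} (hx : x ∈ latticePoints τ) :
    ∃ k : ℕ, x - k • v ∈ subLattice σ := by
  have h1 : (subLattice σ).mkQ x ∈ AddSubmonoid.multiples (normalGenerator σ τ) := by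
    rw [← h.normalGenerator_spec hσ hτ]
    exact ⟨x, hx, rfl⟩
  obtain ⟨k, hk⟩ := (AddSubmonoid.mem_multiples_iff _ _).1 h1
  refine ⟨k, (Submodule.Quotient.eq _).1 ?_⟩
  rw [Submodule.Quotient.mk_smul, hv.2, hk]
  rfl

theorem IsFacet.le_span_sup (h : IsFacet σ τ) (hσ : σ.FG) (hτ : τ.FG) {v : N}
    (hv : IsNormalLift σ τ v) {x : NQ N} (hx : x ∈ τ) :
    ∃ a : ℚ, 0 ≤ a ∧ x - a • toNQ v ∈ Submodule.span ℚ (σ : Set (NQ N)) := by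
  obtain ⟨n, hn, y, hy⟩ := exists_nat_smul_eq_toNQ x
  have hn' : (0 : ℚ) < n := Nat.cast_pos.2 hn
  obtain ⟨k, hk⟩ := h.exists_sub_nsmul_mem hσ hτ hv
    (mem_latticePoints.2 (hy ▸ (smul_mem_nat hn).2 hx))
  refine ⟨k / n, by positivity, ?_⟩
  have := Submodule.smul_mem _ (n : ℚ)⁻¹ (toNQ_mem_span_of_mem_subLattice hk)
  rwa [map_sub, toNQ_nsmul, ← hy, smul_sub, smul_smul, smul_smul, inv_mul_cancel₀ hn'.ne',
    one_smul, inv_mul_eq_div] at this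

theorem IsFacet.notMem_span (h : IsFacet σ τ) (hσ : σ.FG) (hτ : τ.FG) {v : N}
    (hv : IsNormalLift σ τ v) : toNQ v ∉ Submodule.span ℚ (σ : Set (NQ N)) := by
  intro hv0
  refine h.2.1 (h.1.eq_of_span_le (Submodule.span_le.2 fun x hx => ?_))
  obtain ⟨a, -, ha⟩ := h.le_span_sup hσ hτ hv hx
  have := add_mem ha (Submodule.smul_mem _ a hv0)
  rwa [sub_add_cancel] at this

theorem IsFacet.span_eq (h : IsFacet σ τ) (hσ : σ.FG) (hτ : τ.FG) {v : N}
    (hv : IsNormalLift σ τ v) : Submodule.span ℚ (τ : Set (NQ N)) =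
      Submodule.span ℚ (σ : Set (NQ N)) ⊔ Submodule.span ℚ {toNQ v} := by
  refine le_antisymm (Submodule.span_le.2 fun x hx => ?_)
    (sup_le (Submodule.span_mono h.1.le)
      (Submodule.span_mono (Set.singleton_subset_iff.2 hv.1)))
  obtain ⟨a, -, ha⟩ := h.le_span_sup hσ hτ hv hx
  exact Submodule.mem_sup.2 ⟨_, ha, a • toNQ v,
    Submodule.smul_mem _ _ (Submodule.mem_span_singleton_self _), by abel⟩

theorem IsFacet.codim_eq (h : IsFacet σ τ) (hσ : σ.FG) (hτ : τ.FG) :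
    codim σ = codim τ + 1 := by
  obtain ⟨v, hv⟩ := exists_isNormalLift σ τ
  have h1 := codim_add_finrank σ
  have h2 := codim_add_finrank τ
  have h3 := h.span_eq hσ hτ hv
  have h4 : Module.finrank ℚ (Submodule.span ℚ (τ : Set (NQ N))) ≤
      Module.finrank ℚ (Submodule.span ℚ (σ : Set (NQ N))) + 1 := by
    rw [h3]
    refine (Submodule.finrank_add_le_finrank_add_finrank _ _).trans ?_
    exact Nat.add_le_add_left (by simpa using finrank_span_le_card (R := ℚ) {toNQ v}) _
  have h5 : codim σ ≠ codim τ := fun hc => h.2.1 (eq_of_isFaceOf_of_codim_eq h.1 hc)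
  have h6 := codim_anti h.1.le
  omega

/-- n_{τ,σ} is primitive: a functional l in M(σ) with l v ≠ 0 has all its values on N_τ divisible by
l v, so l / l v is integral there and extends to N along a retraction onto N_τ. -/
theorem IsFacet.exists_dualLattice_apply_eq_one (h : IsFacet σ τ) (hσ : σ.FG) (hτ : τ.FG)
    {v : N} (hv : IsNormalLift σ τ v) : ∃ m ∈ dualLattice σ, m v = 1 := by
  obtain ⟨l, hl, hlv⟩ : ∃ l ∈ dualLattice σ, l v ≠ 0 := by
    obtain ⟨f, hfv, hf⟩ := Submodule.exists_le_ker_of_notMem (h.notMem_span hσ hτ hv)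
    obtain ⟨d, hd, l, hl⟩ := exists_smul_eq_rationalize f
    have hf' : f ∈ perp σ := (Submodule.mem_dualAnnihilator _).2 fun x hx => hf hx
    refine ⟨l, rationalize_mem_perp.1 (hl ▸ Submodule.smul_mem _ _ hf'), fun h0 => ?_⟩
    have := rationalize_toNQ l v
    rw [← hl, h0, LinearMap.smul_apply, Int.cast_zero, smul_eq_zero] at this
    exact this.elim (Nat.cast_ne_zero.2 hd.ne') hfv
  have hl0 : ∀ x ∈ subLattice σ, l x = 0 := (Submodule.mem_dualAnnihilator l).1 hl
  have hdvd : ∀ x ∈ subLattice τ, l v ∣ l x := by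
    intro x hx
    induction hx using Submodule.span_induction with
    | mem x hx =>
      obtain ⟨k, hk⟩ := h.exists_sub_nsmul_mem hσ hτ hv hx
      have := hl0 _ hk
      rw [map_sub, map_nsmul, sub_eq_zero] at this
      rw [this]
      exact dvd_smul_of_dvd k dvd_rfl
    | zero => simp
    | add x y _ _ hx hy => rw [map_add]; exact dvd_add hx hy
    | smul a x _ hx => rw [map_smul]; exact dvd_smul_of_dvd a hx
  have htf : Module.IsTorsionFree ℤ (N ⧸ subLattice τ) := isTorsionFree_quotient_subLattice hτ
  obtain ⟨s, hs⟩ := (subLattice τ).mkQ.exists_rightInverse_of_surjective (Submodule.range_mkQ _)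
  have hr : ∀ x, x - s ((subLattice τ).mkQ x) ∈ subLattice τ := by
    intro x
    rw [← Submodule.Quotient.mk_eq_zero, Submodule.Quotient.mk_sub, sub_eq_zero]
    exact (LinearMap.congr_fun hs ((subLattice τ).mkQ x)).symm
  have hs0 : ∀ x ∈ subLattice τ, s ((subLattice τ).mkQ x) = 0 := by
    intro x hx
    have h0 : (subLattice τ).mkQ x = 0 := (Submodule.Quotient.mk_eq_zero _).2 hx
    rw [h0, map_zero]
  let m : N →+ ℤ :=
    { toFun := fun x => l (x - s ((subLattice τ).mkQ x)) / l v
      map_zero' := by simp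
      map_add' := fun x y => by
        rw [← Int.add_ediv_of_dvd_left (hdvd _ (hr x)), ← map_add, map_add, map_add]
        congr 2
        abel }
  have hm : ∀ x ∈ subLattice τ, m x = l x / l v := by
    intro x hx
    change l (x - s ((subLattice τ).mkQ x)) / l v = _
    rw [hs0 x hx, sub_zero]
  refine ⟨m.toIntLinearMap, (Submodule.mem_dualAnnihilator _).2 fun x hx => ?_, ?_⟩
  · change m x = 0
    rw [hm x (subLattice_mono h.1.le hx), hl0 x hx, Int.zero_ediv]
  · change m v = 1
    rw [hm v (Submodule.subset_span hv.1), Int.ediv_self hlv]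

theorem IsFacet.mem_dualLattice_iff (h : IsFacet σ τ) (hσ : σ.FG) (hτ : τ.FG) {v : N}
    (hv : IsNormalLift σ τ v) {m : Module.Dual ℤ N} (hm : m ∈ dualLattice σ) :
    m ∈ dualLattice τ ↔ m v = 0 := by
  constructor
  · intro h1
    exact (Submodule.mem_dualAnnihilator m).1 h1 v (Submodule.subset_span hv.1)
  · intro h1
    refine (Submodule.mem_dualAnnihilator m).2 fun x hx => ?_
    induction hx using Submodule.span_induction with
    | mem x hx =>
      obtain ⟨k, hk⟩ := h.exists_sub_nsmul_mem hσ hτ hv hx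
      have := (Submodule.mem_dualAnnihilator m).1 hm _ hk
      rwa [map_sub, map_nsmul, h1, smul_zero, sub_zero] at this
    | zero => simp
    | add x y _ _ hx hy => rw [map_add, hx, hy, add_zero]
    | smul a x _ hx => rw [map_smul, hx, smul_zero]

end Facet

end Lattice

end ToricCycles

/-! ### Geometry of fans and of proper maps of fans. -/

namespace ToricCycles

section FanGeometry

variable {N : Type*} [AddCommGroup N] {F : Fan N}

theorem Fan.fg (σ : F.cones) : σ.1.FG := F.polyhedral _ σ.2

theorem Fan.isFaceOf_of_le {σ τ : F.cones} (h : σ.1 ≤ τ.1) : σ.1.IsFaceOf τ.1 := by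
  have := (F.inf_face _ σ.2 _ τ.2).2
  rwa [inf_eq_left.2 h] at this

/-- A cone of a fan is contained in every cone of the fan that meets its relative interior. -/
theorem Fan.le_of_isInternal_of_mem {σ τ : F.cones} {w : NQ N} (hw : σ.1.IsInternal w)
    (h : w ∈ τ.1) : σ.1 ≤ τ.1 :=
  (hw.le_of_mem_face le_rfl (F.inf_face _ σ.2 _ τ.2).1 ⟨hw.1, h⟩).trans inf_le_right

/-- Two cones with a common facet `σ` that contain the same ray modulo `σ` are equal. -/
theorem Fan.eq_of_common_ray {σ τ₁ τ₂ : F.cones} (h₁ : IsFacet σ.1 τ₁.1) (h₂ : IsFacet σ.1 τ₂.1)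
    {g₁ g₂ : NQ N} (hg₁ : g₁ ∈ τ₁.1) (hg₂ : g₂ ∈ τ₂.1)
    (hg : g₁ ∉ Submodule.span ℚ (σ.1 : Set (NQ N)))
    (h : g₁ - g₂ ∈ Submodule.span ℚ (σ.1 : Set (NQ N))) : τ₁ = τ₂ := by
  -- The point g₁ + b = g₂ + a lies in both cones but not in σ, so their common face exceeds σ and
  -- must be each of them.
  obtain ⟨a, ha, b, hb, hab⟩ := PointedCone.exists_sub_eq_of_mem_span h
  have hy1 : g₁ + b ∈ τ₁.1 := add_mem hg₁ (h₁.1.le hb)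
  have hy2 : g₁ + b ∈ τ₂.1 := by
    have : g₁ + b = g₂ + a := by
      rw [sub_eq_sub_iff_add_eq_add] at hab
      rw [hab, add_comm]
    rw [this]
    exact add_mem hg₂ (h₂.1.le ha)
  have hyσ : g₁ + b ∉ σ.1 := fun hy =>
    hg (Submodule.subset_span (h₁.1.mem_of_add_mem_left hg₁ (h₁.1.le hb) hy))
  have hface := F.inf_face _ τ₁.2 _ τ₂.2
  have hσ : σ.1 ≤ τ₁.1 ⊓ τ₂.1 := le_inf h₁.1.le h₂.1.le
  have hne : τ₁.1 ⊓ τ₂.1 ≠ σ.1 := fun he => hyσ (he ▸ ⟨hy1, hy2⟩)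
  have e1 := (h₁.2.2 _ hface.1 hσ).resolve_left hne
  have e2 := (h₂.2.2 _ hface.2 hσ).resolve_left hne
  exact Subtype.ext (e1.symm.trans e2)

end FanGeometry

section MapGeometry

variable {N' N : Type*} [AddCommGroup N'] [AddCommGroup N] {F' : Fan N'} {F : Fan N}
  (φ : FanHom F' F)

theorem FanHom.lin_toNQ (v : N') : φ.lin (toNQ v) = toNQ (φ.toLin v) :=
  LinearMap.baseChange_tmul ..

theorem FanHom.lin_mem_span {σ' : PointedCone ℚ (NQ N')} {σ : PointedCone ℚ (NQ N)}
    (h : PointedCone.map φ.lin σ' ≤ σ) {x : NQ N'}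
    (hx : x ∈ Submodule.span ℚ (σ' : Set (NQ N'))) :
    φ.lin x ∈ Submodule.span ℚ (σ : Set (NQ N)) := by
  have : Submodule.span ℚ (σ' : Set (NQ N')) ≤
      (Submodule.span ℚ (σ : Set (NQ N))).comap φ.lin :=
    Submodule.span_le.2 fun y hy => Submodule.subset_span (h ⟨y, hy, rfl⟩)
  exact this hx

theorem FanHom.lin_mem_minCone (σ' : F'.cones) {x : NQ N'} (hx : x ∈ σ'.1) :
    φ.lin x ∈ (φ.minCone σ').1 := φ.map_le_minCone σ' ⟨x, hx, rfl⟩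

/-- The intersection of c(σ') with σ is a face of c(σ') through an internal point of φ(σ'), so it
contains all of φ(σ'). -/
theorem FanHom.minCone_le_of_mem {σ' : F'.cones} {w : NQ N'} (hw : σ'.1.IsInternal w)
    (σ : F.cones) (h : φ.lin w ∈ σ.1) : (φ.minCone σ').1 ≤ σ.1 := by
  refine φ.minCone_le σ' σ (((hw.map φ.lin).le_of_mem_face (φ.map_le_minCone σ')
    (F.inf_face _ (φ.minCone σ').2 _ σ.2).1 ⟨φ.lin_mem_minCone σ' hw.1, h⟩).trans inf_le_right)

/-- The image of an internal point of `σ'` is internal in the smallest cone containing the image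
of `σ'`. -/
theorem FanHom.minCone_isInternal {σ' : F'.cones} {w : NQ N'} (hw : σ'.1.IsInternal w) :
    (φ.minCone σ').1.IsInternal (φ.lin w) := by
  have hmem := φ.lin_mem_minCone σ' hw.1
  have hface := PointedCone.minFace_isFaceOf _ _ hmem
  have hint := PointedCone.minFace_isInternal _ _ hmem
  have hle := φ.minCone_le_of_mem hw
    ⟨_, F.face_mem _ (φ.minCone σ').2 _ hface⟩ hint.1
  rwa [le_antisymm hface.le hle] at hint

theorem FanHom.minCone_mono {σ' τ' : F'.cones} (h : σ'.1 ≤ τ'.1) :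
    (φ.minCone σ').1 ≤ (φ.minCone τ').1 := (φ.minCone_isFaceOf h).le

/-- The internal point `w` of `σ'` can be moved in the direction `v` inside a cone `τ'` of the fan,
as soon as this is possible for the images. -/
theorem FanHom.IsProper.exists_cone [Module.Free ℤ N'] [Module.Finite ℤ N'] {φ : FanHom F' F}
    (hφ : φ.IsProper) {σ' : F'.cones}
    {w v : NQ N'} (hw : σ'.1.IsInternal w) {σ : F.cones}
    (h : ∃ δ : ℚ, 0 < δ ∧ ∀ ε, 0 < ε → ε ≤ δ → φ.lin (w + ε • v) ∈ σ.1) :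
    ∃ τ' : F'.cones, σ'.1 ≤ τ'.1 ∧ ∃ ε : ℚ, 0 < ε ∧ τ'.1.IsInternal (w + ε • v) ∧
      (φ.minCone τ').1 ≤ σ.1 := by
  obtain ⟨δ, hδ, h⟩ := h
  have hsupp : ∀ ε, 0 < ε → ε ≤ δ → ∃ ρ ∈ F'.cones, w + ε • v ∈ ρ := by
    intro ε hε hεδ
    have : w + ε • v ∈ φ.lin ⁻¹' F.support := ⟨σ.1, σ.2, h ε hε hεδ⟩
    rw [hφ] at this
    exact this
  -- Pigeonhole: among finitely many cones, one contains w + εv for arbitrarily small ε. Otherwise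
  -- half the least of δ and all thresholds η gives a point of the support outside every cone.
  obtain ⟨ρ, hρ, hsmall⟩ : ∃ ρ ∈ F'.cones, ∀ η : ℚ, 0 < η →
      ∃ ε, 0 < ε ∧ ε < η ∧ w + ε • v ∈ ρ := by
    by_contra! hcon
    choose! η hη hcon using hcon
    have hne : (insert δ (F'.cones.image η)).Nonempty := Finset.insert_nonempty _ _
    set m := (insert δ (F'.cones.image η)).min' hne
    have hm : 0 < m := by
      refine (Finset.lt_min'_iff _ _).2 fun y hy => ?_
      rcases Finset.mem_insert.1 hy with rfl | hy
      · exact hδ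
      · obtain ⟨ρ, hρ, rfl⟩ := Finset.mem_image.1 hy
        exact hη ρ hρ
    have hmδ : m ≤ δ := Finset.min'_le _ _ (Finset.mem_insert_self _ _)
    obtain ⟨ρ, hρ, hmem⟩ := hsupp (m / 2) (by positivity) (by linarith)
    refine hcon ρ hρ (m / 2) (by positivity) ?_ hmem
    have : m ≤ η ρ :=
      Finset.min'_le _ _ (Finset.mem_insert_of_mem (Finset.mem_image_of_mem _ hρ))
    linarith
  have hwρ : w ∈ ρ := PointedCone.mem_of_forall_exists_add_smul_mem (F'.polyhedral _ hρ) hsmall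
  obtain ⟨ε, hε, hεδ, hmem⟩ := hsmall δ hδ
  -- Halving ε places the new point strictly between w and w + εv, so the smallest face through it
  -- also contains w, and with w all of σ'.
  have hhalf : w + (ε / 2) • v = (1 / 2 : ℚ) • w + (1 / 2 : ℚ) • (w + ε • v) := by module
  have hmem' : w + (ε / 2) • v ∈ ρ := by
    rw [hhalf]
    exact add_mem (ρ.smul_mem (by norm_num) hwρ) (ρ.smul_mem (by norm_num) hmem)
  have hface := PointedCone.minFace_isFaceOf ρ _ hmem'
  have hint := PointedCone.minFace_isInternal ρ _ hmem'
  let τ' : F'.cones := ⟨_, F'.face_mem _ hρ _ hface⟩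
  refine ⟨τ', Fan.le_of_isInternal_of_mem hw ?_, ε / 2, by positivity, hint,
    φ.minCone_le_of_mem (σ' := τ') hint σ (h _ (by positivity) (by linarith))⟩
  refine hface.mem_of_smul_add_smul_mem_left hwρ hmem (a := 1 / 2) (b := 1 / 2)
    (by norm_num) (by norm_num) ?_
  rw [← hhalf]
  exact hint.1

/-! ### Lattice indices and the induced map N'(σ') → N(c(σ')). -/

section Index

theorem mem_map_dualLattice_of_mem {φ : FanHom F' F} {σ' : PointedCone ℚ (NQ N')}
    {σ : PointedCone ℚ (NQ N)} (h : PointedCone.map φ.lin σ' ≤ σ) {m : Module.Dual ℤ N}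
    (hm : m ∈ dualLattice σ) : φ.toLin.dualMap m ∈ dualLattice σ' := by
  refine (Submodule.mem_dualAnnihilator _).2 fun x hx => ?_
  induction hx using Submodule.span_induction with
  | mem x hx =>
    refine (Submodule.mem_dualAnnihilator m).1 hm _ (Submodule.subset_span ?_)
    change toNQ (φ.toLin x) ∈ σ
    rw [← φ.lin_toNQ]
    exact h ⟨_, hx, rfl⟩
  | zero => simp
  | add x y _ _ hx hy => rw [map_add, hx, hy, add_zero]
  | smul a x _ hx => rw [map_smul, hx, smul_zero]

variable [Module.Free ℤ N'] [Module.Finite ℤ N']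

/-- If the index of `σ'` is finite, the induced map `N'(σ')_ℚ → N(c(σ'))_ℚ` is injective. -/
theorem FanHom.mem_span_of_index_ne_zero {φ : FanHom F' F} {σ' : F'.cones} (h : φ.index σ' ≠ 0)
    {x : NQ N'} (hx : φ.lin x ∈ Submodule.span ℚ ((φ.minCone σ').1 : Set (NQ N))) :
    x ∈ Submodule.span ℚ (σ'.1 : Set (NQ N')) := by
  refine mem_span_of_perp fun f hf => ?_
  obtain ⟨d, hd, m, hm⟩ := exists_smul_eq_rationalize f
  have hm' : m ∈ dualLattice σ'.1 :=
    rationalize_mem_perp.1 (hm ▸ Submodule.smul_mem _ _ hf)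
  -- Finite index: a multiple of every m in M'(σ') is pulled back from M(c(σ')), so M'(σ') separates
  -- no more than the image of φ does.
  obtain ⟨n, hn, -, hnm⟩ := AddSubgroup.exists_nsmul_mem_of_relIndex_ne_zero h
    (show m ∈ (dualLattice σ'.1).toAddSubgroup from hm')
  obtain ⟨l, hl, hlm⟩ := hnm.1
  have hlx : rationalize l (φ.lin x) = 0 :=
    (Submodule.mem_dualAnnihilator _).1 (rationalize_mem_perp.2 hl) _ hx
  have hcomp : (n : ℚ) • rationalize m = (rationalize l).comp φ.lin := by
    refine MQ_ext fun v => ?_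
    rw [LinearMap.comp_apply, φ.lin_toNQ, rationalize_toNQ, LinearMap.smul_apply,
      rationalize_toNQ]
    have := LinearMap.congr_fun hlm v
    change l (φ.toLin v) = n • m v at this
    rw [this]
    simp
  have h0 : ((n : ℚ) • rationalize m) x = 0 := by rw [hcomp]; exact hlx
  rw [← hm, LinearMap.smul_apply, LinearMap.smul_apply, smul_eq_mul, smul_eq_mul] at h0
  have hn' : (n : ℚ) ≠ 0 := Nat.cast_ne_zero.2 (Nat.pos_iff_ne_zero.1 hn)
  have hd' : (d : ℚ) ≠ 0 := Nat.cast_ne_zero.2 hd.ne'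
  exact (mul_eq_zero.1 ((mul_eq_zero.1 h0).resolve_left hn')).resolve_left hd'

variable [Module.Finite ℤ N]

/-- An injective map N'(σ')_ℚ → N(c(σ'))_ℚ between spaces of equal dimension is surjective. -/
theorem FanHom.exists_lin_sub_mem_span {φ : FanHom F' F} {σ' : F'.cones} (h : φ.index σ' ≠ 0)
    (hc : codim (φ.minCone σ').1 = codim σ'.1) (y : NQ N) :
    ∃ x : NQ N', φ.lin x - y ∈ Submodule.span ℚ ((φ.minCone σ').1 : Set (NQ N)) := by
  let f := Submodule.mapQ (Submodule.span ℚ (σ'.1 : Set (NQ N')))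
    (Submodule.span ℚ ((φ.minCone σ').1 : Set (NQ N))) φ.lin
    (fun _ hx => φ.lin_mem_span (φ.map_le_minCone σ') hx)
  have hinj : Function.Injective f := by
    rw [← LinearMap.ker_eq_bot, LinearMap.ker_eq_bot']
    intro x hx
    induction x using Submodule.Quotient.induction_on with
    | H x =>
      rw [Submodule.Quotient.mk_eq_zero]
      exact mem_span_of_index_ne_zero h ((Submodule.Quotient.mk_eq_zero _).1 hx)
  obtain ⟨x, hx⟩ := (LinearMap.injective_iff_surjective_of_finrank_eq_finrank hc.symm).1 hinj
    (Submodule.Quotient.mk y)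
  induction x using Submodule.Quotient.induction_on with
  | H x => exact ⟨x, (Submodule.Quotient.eq _).1 hx⟩

variable [Module.Free ℤ N]

/-- For a facet `σ'` of `τ'` and the facet `c(σ')` of `c(τ')`, `φ` multiplies the normal
generator by a positive integer `a`, and the lattice indices differ by the factor `a`. -/
theorem FanHom.exists_index_eq {σ' τ' : F'.cones} (h' : IsFacet σ'.1 τ'.1)
    (h : IsFacet (φ.minCone σ').1 (φ.minCone τ').1) {v' : N'} {v : N}
    (hv' : IsNormalLift σ'.1 τ'.1 v') (hv : IsNormalLift (φ.minCone σ').1 (φ.minCone τ').1 v) :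
    ∃ a : ℕ, φ.toLin v' - a • v ∈ subLattice (φ.minCone σ').1 ∧
      φ.index σ' = a * φ.index τ' := by
  have hmem : φ.toLin v' ∈ latticePoints (φ.minCone τ').1 := by
    rw [mem_latticePoints, ← φ.lin_toNQ]
    exact φ.lin_mem_minCone τ' hv'.1
  obtain ⟨a, ha⟩ := h.exists_sub_nsmul_mem (Fan.fg _) (Fan.fg _) hv hmem
  refine ⟨a, ha, ?_⟩
  -- If a = 0, all of φ(τ') lies in the span of the face c(σ') and hence in c(σ'), so c(τ') would
  -- not be larger.
  have ha0 : a ≠ 0 := by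
    rintro rfl
    rw [zero_smul, sub_zero] at ha
    refine h.2.1 (le_antisymm h.1.le (φ.minCone_le τ' (φ.minCone σ') ?_))
    rintro _ ⟨x, hx, rfl⟩
    refine h.1.mem_of_mem_span (φ.lin_mem_minCone τ' hx) ?_
    obtain ⟨b, -, hb⟩ := h'.le_span_sup (Fan.fg _) (Fan.fg _) hv' hx
    have h1 := φ.lin_mem_span (φ.map_le_minCone σ') hb
    rw [map_sub, map_smul, φ.lin_toNQ] at h1
    have := add_mem h1 (Submodule.smul_mem _ b (toNQ_mem_span_of_mem_subLattice ha))
    rwa [sub_add_cancel] at this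
  obtain ⟨m₀, hm₀, hm₀v⟩ := h'.exists_dualLattice_apply_eq_one (Fan.fg _) (Fan.fg _) hv'
  obtain ⟨n₀, hn₀, hn₀v⟩ := h.exists_dualLattice_apply_eq_one (Fan.fg _) (Fan.fg _) hv
  set A' := (dualLattice σ'.1).toAddSubgroup
  set B' := (dualLattice τ'.1).toAddSubgroup
  set A := ((dualLattice (φ.minCone σ').1).map φ.toLin.dualMap).toAddSubgroup with hA
  set B := ((dualLattice (φ.minCone τ').1).map φ.toLin.dualMap).toAddSubgroup with hB
  have heval : ∀ m ∈ dualLattice (φ.minCone σ').1, m (φ.toLin v') = a * m v := by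
    intro m hm
    have := (Submodule.mem_dualAnnihilator m).1 hm _ ha
    rw [map_sub, map_nsmul, sub_eq_zero, nsmul_eq_mul] at this
    exact this
  have hAA : A ≤ A' := by
    rintro _ ⟨m, hm, rfl⟩
    exact mem_map_dualLattice_of_mem (φ.map_le_minCone σ') hm
  have hBA : B' ≤ A' := fun m hm => Submodule.dualAnnihilator_anti (subLattice_mono h'.1.le) hm
  have hinf : A ⊓ B' = B := by
    ext m'
    constructor
    · rintro ⟨⟨m, hm, rfl⟩, hm'⟩
      refine ⟨m, (h.mem_dualLattice_iff (Fan.fg _) (Fan.fg _) hv hm).2 ?_, rfl⟩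
      have h1 := (h'.mem_dualLattice_iff (Fan.fg _) (Fan.fg _) hv' (hBA hm')).1 hm'
      have h2 : (a : ℤ) * m v = 0 := (heval m hm).symm.trans h1
      exact (mul_eq_zero.1 h2).resolve_left (Int.natCast_ne_zero.2 ha0)
    · rintro ⟨m, hm, rfl⟩
      exact ⟨⟨m, Submodule.dualAnnihilator_anti (subLattice_mono h.1.le) hm, rfl⟩,
        mem_map_dualLattice_of_mem (φ.map_le_minCone τ') hm⟩
  let ev : Module.Dual ℤ N' →+ ℤ := (LinearMap.applyₗ v').toAddMonoidHom
  have hev : ∀ m, ev m = m v' := fun _ => rfl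
  -- Evaluation at v' maps A' onto ℤ, and A ⊔ B' is exactly the part of A' with values in aℤ: B' is
  -- the kernel, and A attains a through n₀.
  have hsup : (A ⊔ B').relIndex A' = a := by
    have h1 : A ⊔ B' = (AddSubgroup.zmultiples (a : ℤ)).comap ev ⊓ A' := by
      refine le_antisymm (sup_le ?_ ?_) ?_
      · rintro _ ⟨m, hm, rfl⟩
        refine ⟨?_, hAA ⟨m, hm, rfl⟩⟩
        exact Int.mem_zmultiples_iff.2 ⟨m v, heval m hm⟩
      · intro m hm
        refine ⟨?_, hBA hm⟩
        have : ev m = 0 := (h'.mem_dualLattice_iff (Fan.fg _) (Fan.fg _) hv' (hBA hm)).1 hm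
        change ev m ∈ AddSubgroup.zmultiples (a : ℤ)
        rw [this]
        exact zero_mem _
      · rintro m ⟨hm, hmA⟩
        obtain ⟨k, hk⟩ := Int.mem_zmultiples_iff.1 hm
        have hkA : φ.toLin.dualMap (k • n₀) ∈ A := ⟨k • n₀, Submodule.smul_mem _ k hn₀, rfl⟩
        have hkB : m - φ.toLin.dualMap (k • n₀) ∈ B' := by
          refine (h'.mem_dualLattice_iff (Fan.fg _) (Fan.fg _) hv' (sub_mem hmA (hAA hkA))).2 ?_
          have h2 := heval n₀ hn₀
          rw [hn₀v, mul_one] at h2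
          have h3 : m v' = a * k := hk
          rw [LinearMap.sub_apply, LinearMap.dualMap_apply, LinearMap.smul_apply, h2, h3,
            smul_eq_mul, mul_comm, sub_self]
        have := AddSubgroup.add_mem_sup hkA hkB
        rwa [add_sub_cancel] at this
    rw [h1, AddSubgroup.inf_relIndex_right, AddSubgroup.relIndex_comap]
    have h2 : A'.map ev = ⊤ := by
      refine eq_top_iff.2 fun k _ => ⟨k • m₀, Submodule.smul_mem _ k hm₀, ?_⟩
      rw [hev, LinearMap.smul_apply, hm₀v, smul_eq_mul, mul_one]
    rw [h2, AddSubgroup.relIndex_top_right, Int.index_zmultiples, Int.natAbs_natCast]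
  -- [A' : A] = [A' : A + B']·[A + B' : A], and the last factor is [B' : A ∩ B'] = [B' : B]. The
  -- identity also holds with infinite indices read as 0.
  have hmul := AddSubgroup.relIndex_mul_relIndex A (A ⊔ B') A' le_sup_left (sup_le hAA hBA)
  rw [sup_comm, AddSubgroup.relIndex_sup_right, ← AddSubgroup.inf_relIndex_right, hinf, sup_comm,
    hsup] at hmul
  exact (hmul.symm.trans (mul_comm _ _))

end Index

end MapGeometry

end ToricCycles

/-! ### Coefficients of the action; the projection formula in equal codimension. -/

namespace ToricCycles

section Action

variable {N : Type*} [AddCommGroup N] {F : Fan N}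

/-- The coefficient of `[V(τ)]` in `D · [V(σ)]`, for a facet `σ` of `τ`. -/
noncomputable def actCoeff (Ψ : Complements F) (D : QCartier F) (σ τ : F.cones) (h : σ.1 ≤ τ.1) : ℚ :=
  pairNormal σ.1 τ.1 (Ψ.projQuot σ τ h (D.eqn τ))

theorem act_orbitClosure (Ψ : Complements F) (D : QCartier F) (σ : F.cones) :
    act Ψ D (orbitClosure F σ) = ∑ τ : {τ : F.cones // IsFacet σ.1 τ.1},
      actCoeff Ψ D σ τ.1 τ.2.1.le • orbitClosure F τ.1 := by
  rw [act, orbitClosure, Finsupp.linearCombination_single, one_smul]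
  rfl

theorem actCoeff_eq (Ψ : Complements F) (D : QCartier F) {σ τ : F.cones} (h : σ.1 ≤ τ.1)
    {m : MQ N} (hm : D.eqn τ = Submodule.Quotient.mk m) {v : N} (hv : IsNormalLift σ.1 τ.1 v) :
    actCoeff Ψ D σ τ h = (Ψ.proj σ m).1 (toNQ v) := by
  rw [actCoeff, hm]
  change pairing σ.1 (normalGenerator σ.1 τ.1) (Ψ.proj σ m) = _
  rw [← hv.2, pairing_mk, toNQ_apply]

theorem perp_apply_eq {σ : PointedCone ℚ (NQ N)} (m : perp σ) {x y : NQ N}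
    (h : x - y ∈ Submodule.span ℚ (σ : Set (NQ N))) : m.1 x = m.1 y := by
  have := (Submodule.mem_dualAnnihilator m.1).1 m.2 _ h
  rwa [map_sub, sub_eq_zero] at this

end Action

section Projection

variable {N' N : Type*} [AddCommGroup N'] [AddCommGroup N] {F' : Fan N'} {F : Fan N}
  (φ : FanHom F' F)

theorem FanHom.pushforward_orbitClosure (σ' : F'.cones) :
    φ.pushforward (orbitClosure F' σ') = if codim (φ.minCone σ').1 = codim σ'.1 then
      (φ.index σ' : ℚ) • orbitClosure F (φ.minCone σ') else 0 := by
  rw [FanHom.pushforward, orbitClosure, Finsupp.linearCombination_single, one_smul]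

theorem FanHom.pullback_eqn {D : QCartier F} {σ' : F'.cones} {σ : F.cones}
    (hσ : φ.minCone σ' = σ) {m : MQ N} (hm : D.eqn σ = Submodule.Quotient.mk m) :
    (φ.pullback D).eqn σ' = Submodule.Quotient.mk (φ.dual m) := by
  subst hσ
  change Submodule.mapQ _ _ φ.dual _ (D.eqn (φ.minCone σ')) = _
  rw [hm]
  rfl

/-- Compatible choices of complements give compatible projections. -/
theorem FanHom.Compatible.proj_dual {φ : FanHom F' F} {Ψ' : Complements F'} {Ψ : Complements F}
    (hΨ : φ.Compatible Ψ' Ψ) {σ' : F'.cones} {σ : F.cones}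
    (h : PointedCone.map φ.lin σ'.1 ≤ σ.1) (hc : codim σ'.1 = codim σ.1) (m : MQ N) :
    (Ψ'.proj σ' (φ.dual m)).1 = φ.dual (Ψ.proj σ m).1 := by
  obtain ⟨p, hp, q, hq, rfl⟩ := Submodule.mem_sup.1
    ((Ψ.isCompl σ).sup_eq_top ▸ Submodule.mem_top : m ∈ perp σ.1 ⊔ Ψ.toFun σ)
  have h1 : Ψ.proj σ (p + q) = ⟨p, hp⟩ := by
    rw [map_add]
    have e1 : Ψ.proj σ p = ⟨p, hp⟩ :=
      Submodule.projectionOnto_apply_left (Ψ.isCompl σ) ⟨p, hp⟩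
    have e2 : Ψ.proj σ q = 0 := 
      Submodule.projectionOnto_apply_right (Ψ.isCompl σ) ⟨q, hq⟩
    rw [e1, e2, add_zero]
  have hp' : φ.dual p ∈ perp σ'.1 := φ.perp_le_comap h hp
  have hq' : φ.dual q ∈ Ψ'.toFun σ' := hΨ σ' σ h hc ⟨q, hq, rfl⟩
  have h2 : Ψ'.proj σ' (φ.dual (p + q)) = ⟨φ.dual p, hp'⟩ := by
    rw [map_add, map_add]
    have e1 : Ψ'.proj σ' (φ.dual p) = ⟨φ.dual p, hp'⟩ :=
      Submodule.projectionOnto_apply_left (Ψ'.isCompl σ') ⟨φ.dual p, hp'⟩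
    have e2 : Ψ'.proj σ' (φ.dual q) = 0 :=
      Submodule.projectionOnto_apply_right (Ψ'.isCompl σ') ⟨_, hq'⟩
    rw [e1, e2, add_zero]
  rw [h1, h2]

variable [Module.Free ℤ N'] [Module.Finite ℤ N']

/-- Directions that map into `τ + span c(σ')` can be followed inside the fan from an internal
point of `σ'`, staying over `τ`. -/
theorem FanHom.IsProper.exists_cone_of_direction {φ : FanHom F' F} (hφ : φ.IsProper)
    {σ' : F'.cones} {w v : NQ N'} (hw : σ'.1.IsInternal w) {τ : F.cones}
    (hτ : (φ.minCone σ').1 ≤ τ.1) {g : NQ N} (hg : g ∈ τ.1)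
    (hv : φ.lin v - g ∈ Submodule.span ℚ ((φ.minCone σ').1 : Set (NQ N))) :
    ∃ τ' : F'.cones, σ'.1 ≤ τ'.1 ∧ ∃ ε : ℚ, 0 < ε ∧ τ'.1.IsInternal (w + ε • v) ∧
      (φ.minCone τ').1 ≤ τ.1 := by
  have hint := φ.minCone_isInternal hw
  obtain ⟨k, hk, hmem⟩ := hint.exists_add_mem hv
  -- φ(w + εv) = (1 - εk)φ(w) + ε(φ(v) - g + kφ(w)) + εg, and all three terms lie in τ once ε ≤ 1/k.
  refine hφ.exists_cone hw ⟨k⁻¹, by positivity, fun ε hε hle => ?_⟩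
  have h1 : ε * k ≤ 1 := by rwa [← le_div_iff₀ hk, one_div]
  have h2 := add_mem (add_mem (τ.1.smul_mem (sub_nonneg.2 h1) (hτ hint.1))
    (τ.1.smul_mem hε.le (hτ hmem))) (τ.1.smul_mem hε.le hg)
  convert h2 using 1
  rw [map_add, map_smul]
  module

variable [Module.Finite ℤ N]

theorem FanHom.isFacet_minCone {σ' τ' : F'.cones} (h : IsFacet σ'.1 τ'.1)
    (hσ : codim (φ.minCone σ').1 = codim σ'.1) (hτ : codim (φ.minCone τ').1 = codim τ'.1) :
    IsFacet (φ.minCone σ').1 (φ.minCone τ').1 := by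
  have h1 := h.codim_eq (Fan.fg _) (Fan.fg _)
  refine isFacet_of_codim (φ.minCone_isFaceOf h.1.le) (fun he => ?_) (by omega)
  rw [he] at hσ
  omega

variable [Module.Free ℤ N]

/-- The factor a by which φ stretches the normal generator is also the ratio of the two indices. -/
theorem FanHom.Compatible.actCoeff_mul_index {φ : FanHom F' F} {Ψ' : Complements F'}
    {Ψ : Complements F} (hΨ : φ.Compatible Ψ' Ψ) (D : QCartier F) {σ' τ' : F'.cones}
    (h' : IsFacet σ'.1 τ'.1) (h : IsFacet (φ.minCone σ').1 (φ.minCone τ').1)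
    (hσ : codim (φ.minCone σ').1 = codim σ'.1) :
    actCoeff Ψ' (φ.pullback D) σ' τ' h'.1.le * φ.index τ' =
      φ.index σ' * actCoeff Ψ D (φ.minCone σ') (φ.minCone τ') h.1.le := by
  obtain ⟨m, hm⟩ := Submodule.Quotient.mk_surjective _ (D.eqn (φ.minCone τ'))
  obtain ⟨v', hv'⟩ := exists_isNormalLift σ'.1 τ'.1
  obtain ⟨v, hv⟩ := exists_isNormalLift (φ.minCone σ').1 (φ.minCone τ').1
  obtain ⟨a, ha, hidx⟩ := φ.exists_index_eq h' h hv' hv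
  have ha' := toNQ_mem_span_of_mem_subLattice ha
  rw [map_sub] at ha'
  rw [actCoeff_eq Ψ' _ _ (φ.pullback_eqn rfl hm.symm) hv', actCoeff_eq Ψ D _ hm.symm hv,
    hΨ.proj_dual (φ.map_le_minCone σ') hσ.symm, hidx]
  have : φ.dual (Ψ.proj (φ.minCone σ') m).1 (toNQ v') =
      a * (Ψ.proj (φ.minCone σ') m).1 (toNQ v) := by
    change (Ψ.proj (φ.minCone σ') m).1 (φ.lin (toNQ v')) = _
    rw [φ.lin_toNQ, perp_apply_eq _ ha', toNQ_nsmul, map_smul, smul_eq_mul]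
  rw [this]
  push_cast
  ring

/-- Lift the normal direction of τ to N'(σ')_ℚ and follow it from inside σ'. The cone τ' reached
lies over τ but not over c(σ'), so c(τ') = τ. -/
theorem FanHom.exists_facet_of_facet {φ : FanHom F' F} (hφ : φ.IsProper)
    (hinv : φ.PreservesInvariant) {σ' : F'.cones} (hσ : codim (φ.minCone σ').1 = codim σ'.1)
    (hidx : φ.index σ' ≠ 0) {τ : F.cones} (h : IsFacet (φ.minCone σ').1 τ.1) :
    ∃ τ' : F'.cones, IsFacet σ'.1 τ'.1 ∧ codim (φ.minCone τ').1 = codim τ'.1 ∧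
      φ.minCone τ' = τ := by
  obtain ⟨w, hw⟩ := PointedCone.exists_isInternal (Fan.fg σ')
  obtain ⟨g, hg⟩ := exists_isNormalLift (φ.minCone σ').1 τ.1
  have hgσ := h.notMem_span (Fan.fg _) (Fan.fg _) hg
  obtain ⟨x, hx⟩ := exists_lin_sub_mem_span hidx hσ (toNQ g)
  obtain ⟨τ', hle, ε, hε, hint, hτ'⟩ := hφ.exists_cone_of_direction hw h.1.le hg.1 hx
  have hxσ : φ.lin x ∉ Submodule.span ℚ ((φ.minCone σ').1 : Set (NQ N)) := fun hxs =>
    hgσ (by simpa using sub_mem hxs hx)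
  have hcne : φ.minCone τ' ≠ φ.minCone σ' := by
    intro he
    refine hxσ ?_
    have h1 := Submodule.subset_span (R := ℚ) (φ.lin_mem_minCone τ' hint.1)
    have h2 := Submodule.subset_span (R := ℚ) (φ.lin_mem_minCone σ' hw.1)
    rw [he, map_add, map_smul] at h1
    have h3 := sub_mem h1 h2
    rw [add_sub_cancel_left] at h3
    exact (Submodule.smul_mem_iff _ hε.ne').1 h3
  have hc : φ.minCone τ' = τ := by
    refine Subtype.ext ((h.2.2 _ (Fan.isFaceOf_of_le hτ') (φ.minCone_mono hle)).resolve_left ?_)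
    exact fun he => hcne (Subtype.ext he)
  -- `hinv` bounds the codimension of τ' below by that of τ, one less than that of σ'; so τ' cannot
  -- be too large.
  have hfac : IsFacet σ'.1 τ'.1 := by
    refine isFacet_of_codim (Fan.isFaceOf_of_le hle) (fun he => hcne ?_) ?_
    · rw [Subtype.ext he]
    · have h1 := hinv τ'
      have h2 := h.codim_eq (Fan.fg _) (Fan.fg _)
      rw [hc] at h1
      omega
  refine ⟨τ', hfac, ?_, hc⟩
  have h1 := hfac.codim_eq (Fan.fg _) (Fan.fg _)
  have h2 := h.codim_eq (Fan.fg _) (Fan.fg _)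
  rw [hc]
  omega

theorem FanHom.eq_of_minCone_eq {φ : FanHom F' F} {σ' τ₁ τ₂ : F'.cones} (hidx : φ.index σ' ≠ 0)
    (h₁ : IsFacet σ'.1 τ₁.1) (h₂ : IsFacet σ'.1 τ₂.1)
    (h : IsFacet (φ.minCone σ').1 (φ.minCone τ₁).1) (he : φ.minCone τ₁ = φ.minCone τ₂) :
    τ₁ = τ₂ := by
  obtain ⟨v₁, hv₁⟩ := exists_isNormalLift σ'.1 τ₁.1
  obtain ⟨v₂, hv₂⟩ := exists_isNormalLift σ'.1 τ₂.1
  have hn₁ := h₁.notMem_span (Fan.fg _) (Fan.fg _) hv₁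
  obtain ⟨v, hv⟩ := exists_isNormalLift (φ.minCone σ').1 (φ.minCone τ₁).1
  obtain ⟨a, ha, hai⟩ := φ.exists_index_eq h₁ h hv₁ hv
  obtain ⟨b, hb, hbi⟩ := φ.exists_index_eq h₂ (he ▸ h) hv₂ (he ▸ hv)
  have ha0 : (a : ℚ) ≠ 0 := by
    rintro h0
    rw [Nat.cast_eq_zero.1 h0, zero_mul] at hai
    exact hidx hai
  have hb0 : (b : ℚ) ≠ 0 := by
    rintro h0
    rw [Nat.cast_eq_zero.1 h0, zero_mul] at hbi
    exact hidx hbi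
  -- φ sends v₁ and v₂ to av and bv modulo N_{c(σ')}, so b v₁ and a v₂ have the same image, and
  -- injectivity identifies them modulo N_{σ'}.
  have hmem : b • v₁ - a • v₂ ∈ subLattice σ'.1 := by
    rw [mem_subLattice_iff (Fan.fg _)]
    refine mem_span_of_index_ne_zero hidx ?_
    rw [φ.lin_toNQ]
    refine toNQ_mem_span_of_mem_subLattice ?_
    have := sub_mem (nsmul_mem ha b) (nsmul_mem hb a)
    convert this using 1
    rw [map_sub, map_nsmul, map_nsmul, smul_sub, smul_sub, smul_smul, smul_smul, mul_comm]
    abel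
  refine Fan.eq_of_common_ray h₁ h₂ (nsmul_mem hv₁.1 b) (nsmul_mem hv₂.1 a) (fun hn => hn₁ ?_)
    ?_
  · have hn' : toNQ (b • v₁) ∈ Submodule.span ℚ (σ'.1 : Set (NQ N')) := hn
    rw [toNQ_nsmul] at hn'
    exact (Submodule.smul_mem_iff _ hb0).1 hn'
  · change toNQ (b • v₁) - toNQ (a • v₂) ∈ Submodule.span ℚ (σ'.1 : Set (NQ N'))
    rw [← map_sub]
    exact toNQ_mem_span_of_mem_subLattice hmem

/-- The projection formula if `V(σ')` and `V(c(σ'))` have the same dimension. -/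
theorem FanHom.projection_formula_of_codim_eq {φ : FanHom F' F} (hφ : φ.IsProper)
    (hinv : φ.PreservesInvariant) {Ψ' : Complements F'} {Ψ : Complements F}
    (hΨ : φ.Compatible Ψ' Ψ) (D : QCartier F) {σ' : F'.cones}
    (hσ : codim (φ.minCone σ').1 = codim σ'.1) :
    φ.pushforward (act Ψ' (φ.pullback D) (orbitClosure F' σ')) =
      act Ψ D (φ.pushforward (orbitClosure F' σ')) := by
  rw [act_orbitClosure, φ.pushforward_orbitClosure, if_pos hσ, map_smul, act_orbitClosure,
    map_sum, Finset.smul_sum]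
  simp only [map_smul, φ.pushforward_orbitClosure, smul_ite, smul_zero]
  rw [← Finset.sum_filter]
  have hterm : ∀ τ' : {τ' : F'.cones // IsFacet σ'.1 τ'.1},
      ∀ hτ : codim (φ.minCone τ'.1).1 = codim τ'.1.1,
      actCoeff Ψ' (φ.pullback D) σ' τ'.1 τ'.2.1.le • (φ.index τ'.1 : ℚ) •
        orbitClosure F (φ.minCone τ'.1) = (φ.index σ' : ℚ) •
      actCoeff Ψ D (φ.minCone σ') (φ.minCone τ'.1) (φ.isFacet_minCone τ'.2 hσ hτ).1.le •
        orbitClosure F (φ.minCone τ'.1) := by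
    intro τ' hτ
    rw [smul_smul, smul_smul, hΨ.actCoeff_mul_index D τ'.2 (φ.isFacet_minCone τ'.2 hσ hτ) hσ]
  by_cases hidx : φ.index σ' = 0
  · simp only [hidx, Nat.cast_zero, zero_smul, Finset.sum_const_zero]
    refine Finset.sum_eq_zero fun τ' hτ' => ?_
    rw [hterm τ' (Finset.mem_filter.1 hτ').2, hidx, Nat.cast_zero, zero_smul]
  · refine Finset.sum_bij (fun τ' hτ' => ⟨φ.minCone τ'.1,
      φ.isFacet_minCone τ'.2 hσ (Finset.mem_filter.1 hτ').2⟩) (fun _ _ => Finset.mem_univ _)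
      ?_ ?_ ?_
    · intro τ₁ h₁ τ₂ h₂ he
      exact Subtype.ext (eq_of_minCone_eq hidx τ₁.2 τ₂.2
        (φ.isFacet_minCone τ₁.2 hσ (Finset.mem_filter.1 h₁).2) (congrArg Subtype.val he))
    · intro τ _
      obtain ⟨τ', hf, hc, he⟩ := exists_facet_of_facet hφ hinv hσ hidx τ.2
      exact ⟨⟨τ', hf⟩, Finset.mem_filter.2 ⟨Finset.mem_univ _, hc⟩, Subtype.ext he⟩
    · intro τ' hτ'
      exact hterm τ' (Finset.mem_filter.1 hτ').2

end Projection

end ToricCycles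

/-! ### The projection formula when the image drops dimension. -/

namespace ToricCycles

section Collapse

variable {N' N : Type*} [AddCommGroup N'] [AddCommGroup N] {F' : Fan N'} {F : Fan N}
  {φ : FanHom F' F} [Module.Free ℤ N'] [Module.Finite ℤ N']

/-- If `τ₁ → σ'` and `V(τ₁)` maps finitely onto `V(c(σ'))`, then there is a second cone `τ₂ → σ'`
on the opposite side of `σ'`, with the same image and the same index. -/
theorem FanHom.exists_opposite_facet (hφ : φ.IsProper) (hinv : φ.PreservesInvariant)
    {σ' τ₁ : F'.cones} (h₁ : IsFacet σ'.1 τ₁.1) (he₁ : φ.minCone τ₁ = φ.minCone σ')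
    (hc₁ : codim (φ.minCone τ₁).1 = codim τ₁.1) (hidx : φ.index τ₁ ≠ 0) {v₁ : N'}
    (hv₁ : IsNormalLift σ'.1 τ₁.1 v₁) :
    ∃ (τ₂ : F'.cones) (v₂ : N'), IsFacet σ'.1 τ₂.1 ∧ φ.minCone τ₂ = φ.minCone σ' ∧
      codim (φ.minCone τ₂).1 = codim τ₂.1 ∧ φ.index τ₂ = φ.index τ₁ ∧
      IsNormalLift σ'.1 τ₂.1 v₂ ∧
      toNQ v₁ + toNQ v₂ ∈ Submodule.span ℚ (σ'.1 : Set (NQ N')) := by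
  obtain ⟨w, hw⟩ := PointedCone.exists_isInternal (Fan.fg σ')
  have hn₁ := h₁.notMem_span (Fan.fg _) (Fan.fg _) hv₁
  -- The image of v₁ lies in c(τ₁) = c(σ'), so the direction -v₁ does not leave the span of c(σ').
  have hv : φ.lin (-toNQ v₁) - 0 ∈ Submodule.span ℚ ((φ.minCone σ').1 : Set (NQ N)) := by
    rw [sub_zero, map_neg, ← he₁]
    exact neg_mem (Submodule.subset_span (φ.lin_mem_minCone τ₁ hv₁.1))
  obtain ⟨τ₂, hle, ε, hε, hint, hτ₂⟩ := hφ.exists_cone_of_direction hw le_rfl (zero_mem _) hv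
  have he₂ : φ.minCone τ₂ = φ.minCone σ' := Subtype.ext (le_antisymm hτ₂ (φ.minCone_mono hle))
  have hcodim := h₁.codim_eq (Fan.fg _) (Fan.fg _)
  have h₂ : IsFacet σ'.1 τ₂.1 := by
    refine isFacet_of_codim (Fan.isFaceOf_of_le hle) (fun he => hn₁ ?_) ?_
    · have h3 := Submodule.subset_span (R := ℚ) hint.1
      rw [← he] at h3
      have h4 := sub_mem h3 (Submodule.subset_span hw.1)
      rw [add_sub_cancel_left, Submodule.smul_mem_iff _ hε.ne'] at h4
      exact neg_mem_iff.1 h4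
    · have := hinv τ₂
      rw [he₂, ← he₁] at this
      omega
  have hc₂ : codim (φ.minCone τ₂).1 = codim τ₂.1 := by
    have := h₂.codim_eq (Fan.fg _) (Fan.fg _)
    rw [he₂, ← he₁]
    omega
  -- τ₂ maps into c(τ₁), and a nonzero index makes N'(τ₁)_ℚ → N(c(τ₁))_ℚ injective; so τ₂ lies in
  -- the span of τ₁. Equal spans give equal lattices and equal indices.
  have hspan : Submodule.span ℚ (τ₂.1 : Set (NQ N')) = Submodule.span ℚ (τ₁.1 : Set (NQ N')) := by
    refine span_eq_of_codim_eq (Submodule.span_le.2 fun x hx => mem_span_of_index_ne_zero hidx ?_)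
      (by rw [← hc₂, ← hc₁, he₁, he₂])
    rw [he₁, ← he₂]
    exact Submodule.subset_span (φ.lin_mem_minCone τ₂ hx)
  have hsub : subLattice τ₂.1 = subLattice τ₁.1 := by
    ext x
    rw [mem_subLattice_iff (Fan.fg _), mem_subLattice_iff (Fan.fg _), hspan]
  obtain ⟨v₂, hv₂⟩ := exists_isNormalLift σ'.1 τ₂.1
  refine ⟨τ₂, v₂, h₂, he₂, hc₂, ?_, hv₂, ?_⟩
  · rw [index, index, dualLattice, dualLattice, dualLattice, hsub, he₁, he₂]
    rfl
  · obtain ⟨a, ha, ha'⟩ := h₂.le_span_sup (Fan.fg _) (Fan.fg _) hv₂ hint.1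
    -- This gives v₁ ≡ -r v₂ modulo σ' with r = a/ε ≥ 0. The functionals m₁, m₂ with value 1 at v₁,
    -- v₂ show that r and its inverse are integers, hence r = 1.
    have hcv : toNQ v₁ + (a / ε) • toNQ v₂ ∈ Submodule.span ℚ (σ'.1 : Set (NQ N')) := by
      have h3 := sub_mem (Submodule.subset_span (R := ℚ) hw.1) ha'
      have h4 := Submodule.smul_mem _ ε⁻¹ h3
      convert h4 using 1
      have : ε⁻¹ * ε = 1 := inv_mul_cancel₀ hε.ne'
      rw [smul_sub, smul_sub, smul_add, smul_smul, smul_smul, this, div_eq_inv_mul]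
      module
    obtain ⟨m₁, hm₁, hm₁v⟩ := h₁.exists_dualLattice_apply_eq_one (Fan.fg _) (Fan.fg _) hv₁
    obtain ⟨m₂, hm₂, hm₂v⟩ := h₂.exists_dualLattice_apply_eq_one (Fan.fg _) (Fan.fg _) hv₂
    have e₁ := (Submodule.mem_dualAnnihilator _).1 (rationalize_mem_perp.2 hm₁) _ hcv
    have e₂ := (Submodule.mem_dualAnnihilator _).1 (rationalize_mem_perp.2 hm₂) _ hcv
    rw [map_add, map_smul, rationalize_toNQ, rationalize_toNQ, smul_eq_mul] at e₁ e₂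
    rw [hm₁v, Int.cast_one] at e₁
    rw [hm₂v, Int.cast_one, mul_one] at e₂
    have hcast : a / ε = ((-m₂ v₁ : ℤ) : ℚ) := by push_cast; linarith
    rw [hcast] at e₁ hcv
    have hunit : (-m₂ v₁) * (-m₁ v₂) = 1 := by
      have : ((-m₂ v₁ : ℤ) : ℚ) * (-m₁ v₂ : ℤ) = 1 := by push_cast at e₁ ⊢; linarith
      exact_mod_cast this
    have hnonneg : 0 ≤ -m₂ v₁ := by
      have : (0 : ℚ) ≤ ((-m₂ v₁ : ℤ) : ℚ) := hcast ▸ div_nonneg ha hε.le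
      exact_mod_cast this
    have hone : -m₂ v₁ = 1 := Int.eq_one_of_mul_eq_one_right hnonneg hunit
    rwa [hone, Int.cast_one, one_smul] at hcv

/-- Nonzero index forces τ into the span of τ₁, which modulo σ' is a line; the sign of the
coordinate b decides which of the two rays τ contains. -/
theorem FanHom.eq_or_eq_of_opposite {σ' τ₁ τ₂ τ : F'.cones} (h₁ : IsFacet σ'.1 τ₁.1)
    (h₂ : IsFacet σ'.1 τ₂.1) (h : IsFacet σ'.1 τ.1) (hidx : φ.index τ₁ ≠ 0)
    (he : φ.minCone τ = φ.minCone τ₁) {v₁ v₂ : N'} (hv₁ : IsNormalLift σ'.1 τ₁.1 v₁)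
    (hv₂ : IsNormalLift σ'.1 τ₂.1 v₂)
    (hv : toNQ v₁ + toNQ v₂ ∈ Submodule.span ℚ (σ'.1 : Set (NQ N'))) : τ = τ₁ ∨ τ = τ₂ := by
  obtain ⟨u, hu⟩ := exists_isNormalLift σ'.1 τ.1
  have hn := h.notMem_span (Fan.fg _) (Fan.fg _) hu
  have hmem : toNQ u ∈ Submodule.span ℚ (τ₁.1 : Set (NQ N')) := by
    refine mem_span_of_index_ne_zero hidx (Submodule.subset_span ?_)
    rw [← he]
    exact φ.lin_mem_minCone τ hu.1
  rw [h₁.span_eq (Fan.fg _) (Fan.fg _) hv₁] at hmem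
  obtain ⟨s, hs, _, hb, hsb⟩ := Submodule.mem_sup.1 hmem
  obtain ⟨b, rfl⟩ := Submodule.mem_span_singleton.1 hb
  rcases le_total 0 b with hb0 | hb0
  · refine Or.inl (Fan.eq_of_common_ray h h₁ hu.1 (τ₁.1.smul_mem hb0 hv₁.1) hn ?_)
    change toNQ u - b • toNQ v₁ ∈ _
    rwa [← hsb, add_sub_cancel_right]
  · refine Or.inr (Fan.eq_of_common_ray h h₂ hu.1
      (τ₂.1.smul_mem (neg_nonneg.2 hb0) hv₂.1) hn ?_)
    change toNQ u - (-b) • toNQ v₂ ∈ _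
    have := add_mem hs (Submodule.smul_mem _ b hv)
    convert this using 1
    rw [← hsb]
    module

/-- The projection formula if the image of `V(σ')` has smaller dimension than `V(σ')`. -/
theorem FanHom.projection_formula_of_codim_lt [Module.Finite ℤ N] (hφ : φ.IsProper)
    (hinv : φ.PreservesInvariant) (Ψ' : Complements F') (Ψ : Complements F) (D : QCartier F)
    {σ' : F'.cones} (hσ : codim (φ.minCone σ').1 < codim σ'.1) :
    φ.pushforward (act Ψ' (φ.pullback D) (orbitClosure F' σ')) =
      act Ψ D (φ.pushforward (orbitClosure F' σ')) := by
  rw [act_orbitClosure, φ.pushforward_orbitClosure σ', if_neg hσ.ne, map_zero, map_sum]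
  simp only [map_smul, φ.pushforward_orbitClosure, smul_ite, smul_zero]
  rw [← Finset.sum_filter]
  set S := Finset.univ.filter fun τ' : {τ' : F'.cones // IsFacet σ'.1 τ'.1} =>
    codim (φ.minCone τ'.1).1 = codim τ'.1.1
  -- For a surviving τ', codim c(τ') = codim σ' - 1 ≥ codim c(σ') ≥ codim c(τ'), so the face c(σ')
  -- is all of c(τ').
  have hmin : ∀ τ' ∈ S, φ.minCone τ'.1 = φ.minCone σ' := by
    intro τ' hτ'
    have h1 := (Finset.mem_filter.1 hτ').2
    have h2 := τ'.2.codim_eq (Fan.fg _) (Fan.fg _)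
    have h3 := codim_anti (φ.minCone_mono τ'.2.1.le)
    exact Subtype.ext (eq_of_isFaceOf_of_codim_eq (φ.minCone_isFaceOf τ'.2.1.le) (by omega)).symm
  have hterm : ∀ τ' ∈ S, actCoeff Ψ' (φ.pullback D) σ' τ'.1 τ'.2.1.le • (φ.index τ'.1 : ℚ) •
      orbitClosure F (φ.minCone τ'.1) =
      (actCoeff Ψ' (φ.pullback D) σ' τ'.1 τ'.2.1.le * φ.index τ'.1) •
        orbitClosure F (φ.minCone σ') := by
    intro τ' hτ'
    rw [smul_smul, hmin τ' hτ']
  rw [Finset.sum_congr rfl hterm, ← Finset.sum_smul]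
  convert zero_smul ℚ _
  by_cases hall : ∀ τ' ∈ S, φ.index τ'.1 = 0
  · exact Finset.sum_eq_zero fun τ' hτ' => by rw [hall τ' hτ', Nat.cast_zero, mul_zero]
  push Not at hall
  obtain ⟨τ₁, hτ₁, hidx⟩ := hall
  obtain ⟨v₁, hv₁⟩ := exists_isNormalLift σ'.1 τ₁.1.1
  obtain ⟨τ₂, v₂, h₂, he₂, hc₂, hidx₂, hv₂, hopp⟩ := exists_opposite_facet hφ hinv τ₁.2
    (hmin τ₁ hτ₁) (Finset.mem_filter.1 hτ₁).2 hidx hv₁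
  -- If τ₁ = τ₂, then v₁ + v₂ would lie in the face σ', hence v₁ as well.
  have hne : τ₁ ≠ ⟨τ₂, h₂⟩ := by
    rintro rfl
    refine h₂.notMem_span (Fan.fg _) (Fan.fg _) hv₁ (Submodule.subset_span ?_)
    exact h₂.1.mem_of_add_mem_left hv₁.1 hv₂.1
      (h₂.1.mem_of_mem_span (add_mem hv₁.1 hv₂.1) hopp)
  have hpair : S = {τ₁, ⟨τ₂, h₂⟩} := by
    ext τ
    rw [Finset.mem_insert, Finset.mem_singleton]
    constructor
    · intro hτ
      rcases eq_or_eq_of_opposite τ₁.2 h₂ τ.2 hidx ((hmin τ hτ).trans (hmin τ₁ hτ₁).symm)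
        hv₁ hv₂ hopp with h | h
      · exact Or.inl (Subtype.ext h)
      · exact Or.inr (Subtype.ext h)
    · rintro (rfl | rfl)
      · exact hτ₁
      · exact Finset.mem_filter.2 ⟨Finset.mem_univ _, hc₂⟩
  obtain ⟨m, hm⟩ := Submodule.Quotient.mk_surjective _ (D.eqn (φ.minCone σ'))
  -- Both cones carry the local equation φ^*(m) of D on c(σ'), evaluated at opposite vectors modulo
  -- the span of σ'.
  have hneg : (Ψ'.proj σ' (φ.dual m)).1 (toNQ v₂) = -(Ψ'.proj σ' (φ.dual m)).1 (toNQ v₁) := by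
    rw [← map_neg]
    refine perp_apply_eq _ ?_
    rwa [sub_neg_eq_add, add_comm]
  rw [hpair, Finset.sum_pair hne, hidx₂,
    actCoeff_eq Ψ' _ _ (φ.pullback_eqn (hmin τ₁ hτ₁) hm.symm) hv₁,
    actCoeff_eq Ψ' _ _ (φ.pullback_eqn he₂ hm.symm) hv₂, hneg]
  ring

end Collapse

end ToricCycles

theorem theorem7p1 {N' N : Type*}
    [AddCommGroup N'] [Module.Free ℤ N'] [Module.Finite ℤ N']
    [AddCommGroup N] [Module.Free ℤ N] [Module.Finite ℤ N]
    {F' : ToricCycles.Fan N'} {F : ToricCycles.Fan N}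
    (φ : ToricCycles.FanHom F' F) (hproper : φ.IsProper) (hinv : φ.PreservesInvariant)
    (Ψ' : ToricCycles.Complements F') (Ψ : ToricCycles.Complements F)
    (hΨ : φ.Compatible Ψ' Ψ)
    (D : ToricCycles.QCartier F) (σ' : F'.cones) :
    φ.pushforward (ToricCycles.act Ψ' (φ.pullback D) (ToricCycles.orbitClosure F' σ')) =
      ToricCycles.act Ψ D (φ.pushforward (ToricCycles.orbitClosure F' σ')) := by
  rcases (hinv σ').eq_or_lt with hσ | hσ
  · exact ToricCycles.FanHom.projection_formula_of_codim_eq hproper hinv hΨ D hσ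
  · exact ToricCycles.FanHom.projection_formula_of_codim_lt hproper hinv Ψ' Ψ D hσ
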